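/- Let $F$ be a field of characteristic $p\ge 0$. For a family $R_0,\dots,R_d$ of relations forming an association scheme on a finite set $X$ and for $x\in X$, put $xR_i=\{z\in X:(x,z)\in R_i\}$. The size $k_i=|xR_i|$, which does not depend on $x$, is the valency of $R_i$. Let $A_i$ be the $\{0,1\}$-adjacency matrix of $R_i$ over $F$, and let $E_i^*(x)$ be the diagonal $\{0,1\}$-matrix over $F$ whose $(y,y)$-entry is $1$ exactly when $y\in xR_i$. The Terwilliger $F$-algebra $T(x)$ is the unital $F$-subalgebra of the full matrix algebra $M_X(F)$ generated by all products $E_a^*(x)A_bE_c^*(x)$ with $0\le a,b,c\le d$. For a finite group $G$ with $|G|\ge 3$, the scheme induced from the Cayley table of $G$ is the scheme on $X_G=\{(x_1,x_2,x_3)\in G^3: x_1x_2=x_3\}$ with relations $R_0=\{(\mathbf x,\mathbf x):\mathbf x\in X_G\}$, $R_j=\{(\mathbf x,\mathbf y): x_j=y_j,\ \mathbf x\ne\mathbf y\}$ for $j=1,2,3$, and $R_4=(X_G\times X_G)\setminus(R_0\cup R_1\cup R_2\cup R_3)$. (i) Let $G$ be an elementary abelian $2$-group of finite order $n\ge 3$,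 let $\mathbf x\in X_G$, and let $T=T(\mathbf x)$ be the Terwilliger $F$-algebra, with respect to $\mathbf x$, of the scheme induced from the Cayley table of $G$. Then $T$ is semisimple if and only if either $p\ne 2,3$ and $n=4$, or none of the congruences $n\equiv 1$, $n\equiv 2$, $n\equiv 4\pmod p$ holds (where congruence modulo $0$ means equality). (ii) If $p\notin\{0,2,3\}$, then there are infinitely many $m\in\mathbb N$ such that, for the elementary abelian $2$-group $G$ of order $2^m\geq 3$, the scheme induced from the Cayley table of $G$ is a symmetric association scheme, none of its valencies is divisible by $p$, and its Terwilliger $F$-algebra $T(\mathbf x)$ is not semisimple for every $\mathbf x\in X_G$. -/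

import Mathlib

/-- `R 0, …, R d` are the relations of an association scheme of class `d` on `X`:
they are nonempty and partition `X × X`, `R 0` is the diagonal, the family is closed under
transposition, and the intersection numbers are well defined. -/
structure IsAssociationScheme {X : Type*} {d : ℕ} (R : Fin (d + 1) → X → X → Prop) : Prop where
  nonempty : ∀ i, ∃ x y, R i x y
  partition : ∀ x y, ∃! i, R i x y
  diagonal : ∀ x y, R 0 x y ↔ x = y
  transpose : ∀ i, ∃ i', ∀ x y, R i' x y ↔ R i y x
  regular : ∀ g h i x y x' y', R i x y → R i x' y' →
    Nat.card {z // R g x z ∧ R h z y} = Nat.card {z // R g x' z ∧ R h z y'}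

/-- The relations form an association scheme, and each of them is symmetric. -/
def IsSymmetricScheme {X : Type*} {d : ℕ} (R : Fin (d + 1) → X → X → Prop) : Prop :=
  IsAssociationScheme R ∧ ∀ i x y, R i x y → R i y x

/-- The size of `xRᵢ = {z | (x, z) ∈ Rᵢ}`. In a scheme this does not depend on `x` and is the
valency `kᵢ` of `Rᵢ`. -/
noncomputable def valency {X : Type*} {d : ℕ} (R : Fin (d + 1) → X → X → Prop)
    (i : Fin (d + 1)) (x : X) : ℕ :=
  Nat.card {z // R i x z}

open Classical in
/-- The adjacency matrix `Aᵢ` over `F`. -/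
noncomputable def adjacencyMatrix (F : Type*) [Field F] {X : Type*} {d : ℕ}
    (R : Fin (d + 1) → X → X → Prop) (i : Fin (d + 1)) : Matrix X X F :=
  Matrix.of fun y z => if R i y z then 1 else 0

open Classical in
/-- The dual idempotent `Eᵢ*(x)` over `F`: the diagonal matrix of the indicator of `xRᵢ`. -/
noncomputable def dualIdempotent (F : Type*) [Field F] {X : Type*} {d : ℕ}
    (R : Fin (d + 1) → X → X → Prop) (i : Fin (d + 1)) (x : X) : Matrix X X F :=
  Matrix.of fun y z => if y = z ∧ R i x y then 1 else 0

/-- The Terwilliger `F`-algebra `T(x)`: the unital `F`-subalgebra of the full matrix algebra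
generated by all products `E_a*(x) A_b E_c*(x)`. -/
noncomputable def terwilligerAlgebra (F : Type*) [Field F] {X : Type*} [Fintype X] [DecidableEq X]
    {d : ℕ} (R : Fin (d + 1) → X → X → Prop) (x : X) : Subalgebra F (Matrix X X F) :=
  Algebra.adjoin F {M | ∃ a b c : Fin (d + 1),
    M = dualIdempotent F R a x * adjacencyMatrix F R b * dualIdempotent F R c x}

/-- The set `X_G` of triples `(x₁, x₂, x₃)` with `x₁ x₂ = x₃` (coordinates are indexed from `0`). -/
abbrev CayleyTriple (G : Type*) [Group G] : Type _ := {x : Fin 3 → G // x 0 * x 1 = x 2}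

/-- `x =_Δ y`: the distinct triples `x` and `y` agree in the coordinate `Δ`. -/
def AgreeAt {G : Type*} [Group G] (j : Fin 3) (x y : CayleyTriple G) : Prop :=
  x.1 j = y.1 j ∧ x ≠ y

/-- The relations `R₀, …, R₄` of the scheme induced from the Cayley table of `G`. -/
def cayleyScheme (G : Type*) [Group G] : Fin (4 + 1) → CayleyTriple G → CayleyTriple G → Prop :=
  ![fun x y => x = y, AgreeAt 0, AgreeAt 1, AgreeAt 2,
    fun x y => x ≠ y ∧ ∀ j, ¬ AgreeAt j x y]

/-- `G` is abelian and each of its elements squares to the identity. -/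
def IsElementaryAbelianTwoGroup (G : Type*) [Group G] : Prop :=
  (∀ a b : G, a * b = b * a) ∧ ∀ a : G, a ^ 2 = 1

/-- The elementary abelian `2`-group of order `2 ^ m`, written multiplicatively. -/
abbrev ElemAbTwo (m : ℕ) : Type := Multiplicative (Fin m → ZMod 2)

/-! Write n = |G| and fix the base point x. In an elementary abelian 2-group each of the three
coordinates of z relative to x is the product of the other two, so they play symmetric roles. Around
x the triples split into {x}, three lines of n - 1 points (one trivial coordinate, the other two
equal), and a generic class of (n - 1)(n - 2) points with three distinct nontrivial coordinates.

Besides the all-one blocks between classes, the algebra T is controlled by six matrices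
(`incMatrix`) recording a coordinate: L_i on the lines and N_i on the generic class. With u the
indicator of G \ {1} and D = diag(u), they satisfy L_i L_jᵀ = δ_ij D, L_i N_jᵀ = 0, N_i N_iᵀ = (n -
2) D, and N_i N_jᵀ = u uᵀ - D for i ≠ j. The all-one blocks, the products of these matrices and the
idempotent of the generic class generate T (`terwilligerGen_mem`,
`incMatrix_mem_terwilligerAlgebra`).

Semisimplicity is decided by norms. The class vectors are orthogonal with norms 1, n - 1, (n - 1)(n
- 2). On vectors of coordinate sum zero the N_i have Gram matrix (n - 1)I - J, with eigenvalues n -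
1, n - 1, n - 4. If no norm vanishes in F, T is a quotient of a product of matrix algebras
(`isSemisimpleRing_terwilligerAlgebra`). If |G| is exactly 4, the eigenvector of norm n - 4 is
itself zero and can be dropped. Otherwise a vanishing norm yields a ≠ 0 in T with aTa = 0
(`not_isSemisimpleRing_of_card_sub_mul_eq_zero`, `not_isSemisimpleRing_of_card_eq_four`).
Characteristics 2 and 3 need no separate argument: there a power of 2 greater than 1 equals 1 or 2
in F.

For the infinite family, Fermat's little theorem gives infinitely many m with 2^m ≡ 4 mod p; the
valencies are then 1, 3, 6 mod p. -/

open Matrix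

/-! ### Coordinates relative to a base point, and the classes around it. -/

section Coordinates

variable {G : Type*} [Group G]

/-- The `i`-th coordinate of the triple `z` relative to the base point `x`. -/
def relCoord (x z : CayleyTriple G) (i : Fin 3) : G := (x.1 i)⁻¹ * z.1 i

theorem relCoord_eq_one {x z : CayleyTriple G} {i : Fin 3} :
    relCoord x z i = 1 ↔ x.1 i = z.1 i := by
  rw [relCoord, inv_mul_eq_one]

theorem relCoord_inj {x y z : CayleyTriple G} {i : Fin 3} :
    relCoord x y i = relCoord x z i ↔ y.1 i = z.1 i := by
  simp [relCoord]

theorem IsElementaryAbelianTwoGroup.mul_self (hG : IsElementaryAbelianTwoGroup G) (a : G) :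
    a * a = 1 := by
  rw [← sq, hG.2]

theorem IsElementaryAbelianTwoGroup.inv_eq (hG : IsElementaryAbelianTwoGroup G) (a : G) :
    a⁻¹ = a := by
  rw [inv_eq_iff_mul_eq_one, hG.mul_self]

theorem relCoord_mul (hG : IsElementaryAbelianTwoGroup G) (x z : CayleyTriple G) :
    relCoord x z 0 * relCoord x z 1 = relCoord x z 2 := by
  simp only [relCoord]
  rw [← x.2, ← z.2, _root_.mul_inv_rev, hG.1 (x.1 1)⁻¹ (x.1 0)⁻¹, mul_assoc, mul_assoc,
    ← mul_assoc (z.1 0), hG.1 (z.1 0), mul_assoc]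

/-- Any two relative coordinates determine the third as their product. -/
theorem exists_third (hG : IsElementaryAbelianTwoGroup G) {i j : Fin 3} (h : i ≠ j) :
    ∃ k, k ≠ i ∧ k ≠ j ∧ (∀ l, l = i ∨ l = j ∨ l = k) ∧
      ∀ x z : CayleyTriple G, relCoord x z k = relCoord x z i * relCoord x z j := by
  have key : ∀ a b c : G, a * b = c →
      c = b * a ∧ b = a * c ∧ b = c * a ∧ a = b * c ∧ a = c * b := by
    rintro a b c rfl
    refine ⟨hG.1 _ _, ?_, ?_, ?_, ?_⟩
    · rw [← mul_assoc, hG.mul_self, one_mul]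
    · rw [hG.1 a, mul_assoc, hG.mul_self, mul_one]
    · rw [hG.1 a, ← mul_assoc, hG.mul_self, one_mul]
    · rw [mul_assoc, hG.mul_self, mul_one]
  have h0 := fun x z : CayleyTriple G => relCoord_mul hG x z
  have h1 := fun x z : CayleyTriple G => key _ _ _ (relCoord_mul hG x z)
  fin_cases i <;> fin_cases j
  · exact absurd rfl h
  · exact ⟨2, by decide, by decide, by decide, fun x z => (h0 x z).symm⟩
  · exact ⟨1, by decide, by decide, by decide, fun x z => (h1 x z).2.1⟩
  · exact ⟨2, by decide, by decide, by decide, fun x z => (h1 x z).1⟩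
  · exact absurd rfl h
  · exact ⟨0, by decide, by decide, by decide, fun x z => (h1 x z).2.2.2.1⟩
  · exact ⟨1, by decide, by decide, by decide, fun x z => (h1 x z).2.2.1⟩
  · exact ⟨0, by decide, by decide, by decide, fun x z => (h1 x z).2.2.2.2⟩
  · exact absurd rfl h

theorem ext_of_relCoord (hG : IsElementaryAbelianTwoGroup G) {x y z : CayleyTriple G}
    {i j : Fin 3} (h : i ≠ j) (hi : relCoord x y i = relCoord x z i)
    (hj : relCoord x y j = relCoord x z j) : y = z := by
  obtain ⟨k, -, -, hl, hk⟩ := exists_third hG h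
  apply Subtype.ext
  funext l
  rw [← relCoord_inj (x := x)]
  rcases hl l with rfl | rfl | rfl
  · exact hi
  · exact hj
  · rw [hk, hk, hi, hj]

theorem relCoord_self (x : CayleyTriple G) (i : Fin 3) : relCoord x x i = 1 := by
  simp [relCoord]

theorem cayleyScheme_zero (x z : CayleyTriple G) : cayleyScheme G 0 x z ↔ x = z := Iff.rfl

theorem cayleyScheme_succ (i : Fin 3) (x z : CayleyTriple G) :
    cayleyScheme G ((i.castSucc).succ) x z ↔ x.1 i = z.1 i ∧ x ≠ z := by
  fin_cases i <;> exact Iff.rfl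

theorem cayleyScheme_four (x z : CayleyTriple G) :
    cayleyScheme G 4 x z ↔ x ≠ z ∧ ∀ j, x.1 j ≠ z.1 j := by
  change (x ≠ z ∧ ∀ j, ¬ (x.1 j = z.1 j ∧ x ≠ z)) ↔ _
  constructor
  · rintro ⟨h, h'⟩
    exact ⟨h, fun j hj => h' j ⟨hj, h⟩⟩
  · rintro ⟨h, h'⟩
    exact ⟨h, fun j hj => h' j hj.1⟩

theorem cayleyScheme_succ_iff (hG : IsElementaryAbelianTwoGroup G) {i j : Fin 3} (h : i ≠ j)
    (x z : CayleyTriple G) : cayleyScheme G ((i.castSucc).succ) x z ↔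
      relCoord x z i = 1 ∧ relCoord x z j ≠ 1 := by
  rw [cayleyScheme_succ, ← relCoord_eq_one]
  refine and_congr_right fun hi => not_congr ⟨?_, fun hj => ?_⟩
  · rintro rfl
    exact relCoord_self _ _
  · exact ext_of_relCoord hG (x := x) h (by rw [hi, relCoord_self]) (by rw [hj, relCoord_self])

/-- Elements of G are involutions, so the third coordinate is trivial exactly when the other two
agree. -/
theorem cayleyScheme_four_iff (hG : IsElementaryAbelianTwoGroup G) {i j : Fin 3} (h : i ≠ j)
    (x z : CayleyTriple G) : cayleyScheme G 4 x z ↔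
      relCoord x z i ≠ 1 ∧ relCoord x z j ≠ 1 ∧ relCoord x z i ≠ relCoord x z j := by
  obtain ⟨k, -, -, hl, hk⟩ := exists_third hG h
  have hk' : relCoord x z k = 1 ↔ relCoord x z i = relCoord x z j := by
    rw [hk, mul_eq_one_iff_eq_inv, hG.inv_eq]
  rw [cayleyScheme_four]
  simp only [ne_eq, ← relCoord_eq_one]
  constructor
  · rintro ⟨-, h'⟩
    exact ⟨h' i, h' j, fun e => h' k (hk'.2 e)⟩
  · rintro ⟨hi, hj, hij⟩
    refine ⟨?_, fun l => ?_⟩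
    · rintro rfl
      exact hi (relCoord_self _ _)
    · rcases hl l with rfl | rfl | rfl
      · exact hi
      · exact hj
      · rwa [hk']

/-- The line relation in direction `i`, as an index of the scheme. -/
abbrev lineIdx (i : Fin 3) : Fin (4 + 1) := (i.castSucc).succ

theorem fin_five_cases (c : Fin (4 + 1)) : c = 0 ∨ (∃ i, c = lineIdx i) ∨ c = 4 := by
  fin_cases c
  · exact Or.inl rfl
  · exact Or.inr (Or.inl ⟨0, rfl⟩)
  · exact Or.inr (Or.inl ⟨1, rfl⟩)
  · exact Or.inr (Or.inl ⟨2, rfl⟩)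
  · exact Or.inr (Or.inr rfl)

theorem cayleyScheme_existsUnique (hG : IsElementaryAbelianTwoGroup G) (x z : CayleyTriple G) :
    ∃! c, cayleyScheme G c x z := by
  by_cases h : x = z
  · subst h
    refine ⟨0, rfl, fun c hc => ?_⟩
    rcases fin_five_cases c with rfl | ⟨i, rfl⟩ | rfl
    · rfl
    · exact absurd rfl ((cayleyScheme_succ _ _ _).1 hc).2
    · exact absurd rfl ((cayleyScheme_four _ _).1 hc).1
  · by_cases h' : ∃ i, x.1 i = z.1 i
    · obtain ⟨i, hi⟩ := h'
      refine ⟨lineIdx i, (cayleyScheme_succ _ _ _).2 ⟨hi, h⟩, fun c hc => ?_⟩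
      rcases fin_five_cases c with rfl | ⟨j, rfl⟩ | rfl
      · exact absurd hc h
      · by_contra hij
        have hij : j ≠ i := fun e => hij (by rw [e])
        exact ((cayleyScheme_succ_iff hG hij x z).1 hc).2 (relCoord_eq_one.2 hi)
      · exact absurd hi (((cayleyScheme_four _ _).1 hc).2 i)
    · push Not at h'
      refine ⟨4, (cayleyScheme_four _ _).2 ⟨h, h'⟩, fun c hc => ?_⟩
      rcases fin_five_cases c with rfl | ⟨j, rfl⟩ | rfl
      · exact absurd hc h
      · exact absurd ((cayleyScheme_succ _ _ _).1 hc).1 (h' j)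
      · rfl

variable [Fintype G] [DecidableEq G]

theorem card_cayleyTriple : Fintype.card (CayleyTriple G) = Fintype.card (G × G) := by
  refine Fintype.card_congr
    ⟨fun z => (z.1 0, z.1 1), fun p => ⟨![p.1, p.2, p.1 * p.2], rfl⟩, fun z => ?_, fun p => rfl⟩
  apply Subtype.ext
  funext i
  fin_cases i
  · rfl
  · rfl
  · exact z.2

theorem relCoord_bijective (hG : IsElementaryAbelianTwoGroup G) {i j : Fin 3} (h : i ≠ j)
    (x : CayleyTriple G) :
    Function.Bijective fun z : CayleyTriple G => (relCoord x z i, relCoord x z j) := by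
  rw [Fintype.bijective_iff_injective_and_card]
  refine ⟨fun y z hyz => ?_, card_cayleyTriple⟩
  simp only [Prod.mk.injEq] at hyz
  exact ext_of_relCoord hG h hyz.1 hyz.2

/-- Turns sums over triples into double sums over G in any two directions; the incidence counts
below rest on it. -/
theorem sum_relCoord {M : Type*} [AddCommMonoid M] (hG : IsElementaryAbelianTwoGroup G)
    {i j : Fin 3} (h : i ≠ j) (x : CayleyTriple G) (f : G → G → M) :
    ∑ z : CayleyTriple G, f (relCoord x z i) (relCoord x z j) = ∑ g, ∑ h, f g h := by
  rw [(relCoord_bijective hG h x).sum_comp (fun p : G × G => f p.1 p.2), Fintype.sum_prod_type]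

end Coordinates

/-! ### Ring-theoretic criteria for semisimplicity and its failure. -/

section Semisimple

variable {F A : Type*} [Field F] [Ring A] [Algebra F A]

/-- In a semisimple ring the left ideal of a is generated by an idempotent e = ta. Then e = e² =
t(ata) = 0, which forces a = 0. -/
theorem not_isSemisimpleRing_of_mul_mul_eq_zero {R : Type*} [Ring R] {a : R} (ha : a ≠ 0)
    (h : ∀ t, a * t * a = 0) : ¬ IsSemisimpleRing R := by
  intro hR
  obtain ⟨e, he, hI⟩ := IsSemisimpleRing.ideal_eq_span_idempotent (Ideal.span {a})
  have h1 : e ∈ Ideal.span {a} := hI ▸ Ideal.mem_span_singleton_self e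
  have h2 : a ∈ Ideal.span {e} := hI ▸ Ideal.mem_span_singleton_self a
  obtain ⟨t, rfl⟩ := Ideal.mem_span_singleton'.1 h1
  obtain ⟨s, hs⟩ := Ideal.mem_span_singleton'.1 h2
  have h0 : t * a = 0 := by
    rw [← he.eq, mul_assoc, ← mul_assoc a, h, mul_zero]
  rw [h0, mul_zero] at hs
  exact ha hs.symm

/-- The maps need not preserve 1, so a factor F is added for the complementary idempotent 1 - φ 1 -
ψ 1. The resulting S is a quotient of R₁ × R₂ × F, hence semisimple. -/
theorem exists_isSemisimpleRing_subalgebra {R₁ R₂ : Type*} [Ring R₁] [Algebra F R₁] [Ring R₂]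
    [Algebra F R₂] [IsSemisimpleRing R₁] [IsSemisimpleRing R₂]
    (φ : R₁ →ₙₐ[F] A) (ψ : R₂ →ₙₐ[F] A) (h₁ : ∀ a b, φ a * ψ b = 0) (h₂ : ∀ a b, ψ b * φ a = 0) :
    ∃ S : Subalgebra F A, IsSemisimpleRing S ∧ (∀ a, φ a ∈ S) ∧ (∀ b, ψ b ∈ S) ∧
      ∀ T : Subalgebra F A, (∀ a, φ a ∈ T) → (∀ b, ψ b ∈ T) → S ≤ T := by
  have e1 : ∀ a, φ a * φ 1 = φ a := fun a => by rw [← map_mul, mul_one]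
  have e2 : ∀ a, φ 1 * φ a = φ a := fun a => by rw [← map_mul, one_mul]
  have e3 : ∀ a, ψ a * ψ 1 = ψ a := fun a => by rw [← map_mul, mul_one]
  have e4 : ∀ a, ψ 1 * ψ a = ψ a := fun a => by rw [← map_mul, one_mul]
  let f : (R₁ × R₂) × F →ₗ[F] A :=
    { toFun := fun r => φ r.1.1 + ψ r.1.2 + r.2 • (1 - φ 1 - ψ 1)
      map_add' := fun r s => by
        simp only [Prod.fst_add, Prod.snd_add, map_add, add_smul]
        abel
      map_smul' := fun c r => by
        simp only [Prod.smul_fst, Prod.smul_snd, map_smul, smul_add, smul_smul, RingHom.id_apply,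
          smul_eq_mul] }
  let Φ : (R₁ × R₂) × F →ₐ[F] A := AlgHom.ofLinearMap f
    (by simp [f])
    (fun r s => by
      simp only [f, LinearMap.coe_mk, AddHom.coe_mk, Prod.fst_mul, Prod.snd_mul, map_mul, mul_add,
        add_mul, mul_sub, sub_mul, h₁, h₂, e1, e2, e3, e4, smul_mul_assoc, mul_smul_comm, mul_one,
        one_mul, mul_smul, sub_self, smul_zero, sub_zero, add_zero, zero_add]
      have e : ∀ a b c : A, a + b + c - a - b = c := fun a b c => by abel
      rw [e, smul_comm])
  refine ⟨Φ.range, ?_, fun a => ⟨((a, 0), 0), ?_⟩, fun b => ⟨((0, b), 0), ?_⟩, ?_⟩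
  · exact RingHom.isSemisimpleRing_of_surjective (Φ.rangeRestrict : (R₁ × R₂) × F →+* Φ.range)
      Φ.rangeRestrict_surjective
  · simp [Φ, f]
  · simp [Φ, f]
  · rintro T hφ hψ _ ⟨r, rfl⟩
    change φ r.1.1 + ψ r.1.2 + r.2 • (1 - φ 1 - ψ 1) ∈ T
    exact add_mem (add_mem (hφ _) (hψ _))
      (T.smul_mem (sub_mem (sub_mem (one_mem _) (hφ _)) (hψ _)) _)

/-- Matrices `P s` whose products `P s * (P t)ᵀ` are `m s • E` for `s = t` and vanish otherwise
give a copy of a full matrix algebra. -/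
noncomputable def gramHom {σ κ X : Type*} [Fintype σ] [DecidableEq σ] [Fintype κ] [Fintype X]
    (P : σ → Matrix κ X F) (E : Matrix κ κ F) (m : σ → F) (hm : ∀ s, m s ≠ 0)
    (hP : ∀ s t, P s * (P t)ᵀ = if s = t then m s • E else 0) (hE : ∀ s, E * P s = P s) :
    Matrix σ σ F →ₙₐ[F] Matrix X X F where
  toFun C := ∑ s, ∑ t, (C s t * (m t)⁻¹) • ((P s)ᵀ * P t)
  map_smul' c C := by
    simp only [Matrix.smul_apply, smul_eq_mul, mul_assoc, mul_smul, Finset.smul_sum,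
      MonoidHom.id_apply]
  map_zero' := by simp
  map_add' C D := by
    simp only [Matrix.add_apply, add_mul, add_smul, Finset.sum_add_distrib]
  map_mul' C D := by
    -- Only the inner product of the two middle factors matters: it is a multiple of E, which the
    -- next factor absorbs, or zero.
    have key : ∀ s t u v, (P s)ᵀ * P t * ((P u)ᵀ * P v) =
        if t = u then m t • ((P s)ᵀ * P v) else 0 := by
      intro s t u v
      rw [Matrix.mul_assoc, ← Matrix.mul_assoc (P t), hP]
      split_ifs
      · rw [Matrix.smul_mul, hE, Matrix.mul_smul]
      · rw [Matrix.zero_mul, Matrix.mul_zero]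
    have key2 : ∀ s t, (P s)ᵀ * P t * (∑ u, ∑ v, (D u v * (m v)⁻¹) • ((P u)ᵀ * P v)) =
        ∑ v, (m t * D t v * (m v)⁻¹) • ((P s)ᵀ * P v) := by
      intro s t
      rw [Finset.mul_sum, Finset.sum_eq_single t]
      · rw [Finset.mul_sum]
        refine Finset.sum_congr rfl fun v _ => ?_
        rw [Matrix.mul_smul, key, if_pos rfl, smul_smul]
        congr 1
        ring
      · intro u _ hu
        rw [Finset.mul_sum]
        refine Finset.sum_eq_zero fun v _ => ?_
        rw [Matrix.mul_smul, key, if_neg (Ne.symm hu), smul_zero]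
      · exact fun h => absurd (Finset.mem_univ _) h
    rw [Finset.sum_mul]
    refine Finset.sum_congr rfl fun s _ => ?_
    simp only [Finset.sum_mul, Matrix.smul_mul, key2, Finset.smul_sum, Matrix.mul_apply,
      Finset.sum_smul, smul_smul]
    rw [Finset.sum_comm]
    refine Finset.sum_congr rfl fun t _ => Finset.sum_congr rfl fun v _ => ?_
    congr 1
    have := hm t
    field_simp

theorem transpose_mul_mem_of_gramHom_mem {σ κ X : Type*} [Fintype σ] [DecidableEq σ] [Fintype κ]
    [Fintype X] {P : σ → Matrix κ X F} {E : Matrix κ κ F} {m : σ → F} {hm : ∀ s, m s ≠ 0}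
    {hP : ∀ s t, P s * (P t)ᵀ = if s = t then m s • E else 0} {hE : ∀ s, E * P s = P s}
    [DecidableEq X] {S : Subalgebra F (Matrix X X F)} (h : ∀ C, gramHom P E m hm hP hE C ∈ S)
    (s t : σ) : (P s)ᵀ * P t ∈ S := by
  -- The entry m t of the matrix unit cancels the weight (m t)⁻¹ built into `gramHom`.
  have := h (Matrix.single s t (m t))
  change ∑ u, ∑ v, (Matrix.single s t (m t) u v * (m v)⁻¹) • ((P u)ᵀ * P v) ∈ S at this
  rwa [Finset.sum_eq_single s, Finset.sum_eq_single t, Matrix.single_apply_same,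
    mul_inv_cancel₀ (hm t), one_smul] at this
  · intro v _ hv
    rw [Matrix.single_apply_of_col_ne _ _ (Ne.symm hv), zero_mul, zero_smul]
  · exact fun h => absurd (Finset.mem_univ _) h
  · intro u _ hu
    refine Finset.sum_eq_zero fun v _ => ?_
    rw [Matrix.single_apply_of_row_ne (Ne.symm hu), zero_mul, zero_smul]
  · exact fun h => absurd (Finset.mem_univ _) h

theorem gramHom_mem {σ κ X : Type*} [Fintype σ] [DecidableEq σ] [Fintype κ]
    [Fintype X] {P : σ → Matrix κ X F} {E : Matrix κ κ F} {m : σ → F} {hm : ∀ s, m s ≠ 0}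
    {hP : ∀ s t, P s * (P t)ᵀ = if s = t then m s • E else 0} {hE : ∀ s, E * P s = P s}
    [DecidableEq X] {S : Subalgebra F (Matrix X X F)} (h : ∀ s t, (P s)ᵀ * P t ∈ S)
    (C : Matrix σ σ F) : gramHom P E m hm hP hE C ∈ S :=
  sum_mem fun s _ => sum_mem fun t _ => S.smul_mem (h s t) _

theorem gramHom_mul_gramHom_eq_zero {σ κ τ ι X : Type*} [Fintype σ] [DecidableEq σ] [Fintype κ]
    [Fintype τ] [DecidableEq τ] [Fintype ι] [Fintype X] {P : σ → Matrix κ X F} {E : Matrix κ κ F}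
    {m : σ → F} {hm : ∀ s, m s ≠ 0} {hP : ∀ s t, P s * (P t)ᵀ = if s = t then m s • E else 0}
    {hE : ∀ s, E * P s = P s} {P' : τ → Matrix ι X F} {E' : Matrix ι ι F} {m' : τ → F}
    {hm' : ∀ s, m' s ≠ 0} {hP' : ∀ s t, P' s * (P' t)ᵀ = if s = t then m' s • E' else 0}
    {hE' : ∀ s, E' * P' s = P' s} (h : ∀ s t, P s * (P' t)ᵀ = 0) (C : Matrix σ σ F)
    (D : Matrix τ τ F) : gramHom P E m hm hP hE C * gramHom P' E' m' hm' hP' hE' D = 0 := by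
  change (∑ s, ∑ t, (C s t * (m t)⁻¹) • ((P s)ᵀ * P t)) *
    (∑ u, ∑ v, (D u v * (m' v)⁻¹) • ((P' u)ᵀ * P' v)) = 0
  have key : ∀ s t u v, (P s)ᵀ * P t * ((P' u)ᵀ * P' v) = 0 := fun s t u v => by
    rw [Matrix.mul_assoc, ← Matrix.mul_assoc (P t), h, Matrix.zero_mul, Matrix.mul_zero]
  simp only [Finset.sum_mul, Finset.mul_sum, Matrix.smul_mul, Matrix.mul_smul, key, smul_zero,
    Finset.sum_const_zero]

end Semisimple

/-! ### Indicator vectors of the classes. -/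

section Blocks

variable (F : Type*) [Field F] {G : Type*} [Group G]

open Classical in
/-- The indicator vector of the class `c` around `x`. -/
noncomputable def classVec (x : CayleyTriple G) (c : Fin (4 + 1)) : CayleyTriple G → F :=
  fun z => if cayleyScheme G c x z then 1 else 0

variable {F} {x : CayleyTriple G}

theorem classVec_mul (hG : IsElementaryAbelianTwoGroup G) (a c : Fin (4 + 1))
    (z : CayleyTriple G) :
    classVec F x a z * classVec F x c z = if a = c then classVec F x a z else 0 := by
  obtain ⟨d, hd, hu⟩ := cayleyScheme_existsUnique hG x z
  have : ∀ c, cayleyScheme G c x z ↔ c = d := fun c => ⟨hu c, fun h => h ▸ hd⟩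
  simp only [classVec, this]
  split_ifs <;> simp_all

theorem sum_classVec (hG : IsElementaryAbelianTwoGroup G) (z : CayleyTriple G) :
    ∑ c, classVec F x c z = 1 := by
  obtain ⟨d, hd, hu⟩ := cayleyScheme_existsUnique hG x z
  have : ∀ c, cayleyScheme G c x z ↔ c = d := fun c => ⟨hu c, fun h => h ▸ hd⟩
  simp [classVec, this]

variable [DecidableEq G]

theorem classVec_line (hG : IsElementaryAbelianTwoGroup G) {i j : Fin 3} (h : i ≠ j)
    (z : CayleyTriple G) : classVec F x (lineIdx i) z =
      if relCoord x z i = 1 ∧ relCoord x z j ≠ 1 then 1 else 0 := by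
  simp only [classVec, cayleyScheme_succ_iff hG h]

theorem classVec_four (hG : IsElementaryAbelianTwoGroup G) {i j : Fin 3} (h : i ≠ j)
    (z : CayleyTriple G) : classVec F x 4 z =
      if relCoord x z i ≠ 1 ∧ relCoord x z j ≠ 1 ∧ relCoord x z i ≠ relCoord x z j
      then 1 else 0 := by
  simp only [classVec, cayleyScheme_four_iff hG h]

theorem classVec_zero (z : CayleyTriple G) : classVec F x 0 z = if x = z then 1 else 0 := by
  simp only [classVec, cayleyScheme_zero]

end Blocks

/-! ### Incidence matrices and their Gram relations. -/

section Blocks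

variable (F : Type*) [Field F] {G : Type*} [Group G] [DecidableEq G]

/-- The incidence matrix between the group and the class `c` through the `j`-th coordinate. -/
noncomputable def coordMatrix (x : CayleyTriple G) (c : Fin (4 + 1)) (j : Fin 3) :
    Matrix G (CayleyTriple G) F :=
  Matrix.of fun g z => classVec F x c z * if relCoord x z j = g then 1 else 0

/-- The incidence matrix of the line in direction `i`. -/
noncomputable def lineMatrix (x : CayleyTriple G) (i : Fin 3) : Matrix G (CayleyTriple G) F :=
  coordMatrix F x (lineIdx i) (i + 1)

/-- The incidence matrix of the generic class through the `i`-th coordinate. -/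
noncomputable def genMatrix (x : CayleyTriple G) (i : Fin 3) : Matrix G (CayleyTriple G) F :=
  coordMatrix F x 4 i

/-- The indicator vector of the non-identity elements. -/
def nonOneVec (G : Type*) [Group G] [DecidableEq G] : G → F := fun g => if g = 1 then 0 else 1

variable {F} {x : CayleyTriple G}

theorem ne_add_one (i : Fin 3) : i ≠ i + 1 := by
  fin_cases i <;> decide

/-- On the line in direction i the other two coordinates agree, so the choice of i + 1 in
`lineMatrix` is immaterial. -/
theorem coordMatrix_line (hG : IsElementaryAbelianTwoGroup G) {i j : Fin 3} (h : i ≠ j) :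
    coordMatrix F x (lineIdx i) j = lineMatrix F x i := by
  ext g z
  simp only [coordMatrix, lineMatrix, Matrix.of_apply, classVec_line hG h]
  by_cases hz : relCoord x z i = 1
  · have : relCoord x z (i + 1) = relCoord x z j := by
      obtain ⟨k, -, -, hl, hk⟩ := exists_third hG h
      rcases hl (i + 1) with e | e | e
      · exact absurd e.symm (ne_add_one i)
      · rw [e]
      · rw [e, hk, hz, one_mul]
    rw [this]
  · simp [hz]

variable [Fintype G]

theorem lineMatrix_mul_transpose_self (hG : IsElementaryAbelianTwoGroup G) (i : Fin 3) :
    lineMatrix F x i * (lineMatrix F x i)ᵀ = diagonal (nonOneVec F G) := by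
  ext g h
  simp only [Matrix.mul_apply, lineMatrix, coordMatrix, Matrix.transpose_apply, Matrix.of_apply,
    classVec_line hG (ne_add_one i)]
  rw [sum_relCoord hG (ne_add_one i) x fun a b => (if a = 1 ∧ b ≠ 1 then (1 : F) else 0) *
    (if b = g then 1 else 0) * ((if a = 1 ∧ b ≠ 1 then 1 else 0) * if b = h then 1 else 0)]
  rw [Finset.sum_eq_single 1, Finset.sum_eq_single g]
  · simp only [nonOneVec, diagonal_apply]
    split_ifs <;> simp_all
  · intro b _ hb
    simp [hb]
  · simp
  · intro a _ ha
    simp [ha]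
  · simp

theorem coordMatrix_mul_transpose_of_ne (hG : IsElementaryAbelianTwoGroup G)
    {a c : Fin (4 + 1)} (hac : a ≠ c) (i j : Fin 3) :
    coordMatrix F x a i * (coordMatrix F x c j)ᵀ = 0 := by
  ext g h
  simp only [Matrix.mul_apply, coordMatrix, Matrix.transpose_apply, Matrix.of_apply,
    mul_mul_mul_comm (classVec F x a _), classVec_mul hG, if_neg hac, zero_mul,
    Finset.sum_const_zero, Matrix.zero_apply]

theorem lineIdx_ne_four (i : Fin 3) : lineIdx i ≠ 4 := by
  fin_cases i <;> decide

theorem lineIdx_injective : Function.Injective lineIdx := by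
  decide

theorem lineMatrix_mul_transpose (hG : IsElementaryAbelianTwoGroup G) (i j : Fin 3) :
    lineMatrix F x i * (lineMatrix F x j)ᵀ = if i = j then diagonal (nonOneVec F G) else 0 := by
  split_ifs with h
  · rw [h, lineMatrix_mul_transpose_self hG]
  · exact coordMatrix_mul_transpose_of_ne hG (fun e => h (lineIdx_injective e)) _ _

theorem lineMatrix_mul_genMatrix (hG : IsElementaryAbelianTwoGroup G) (i j : Fin 3) :
    lineMatrix F x i * (genMatrix F x j)ᵀ = 0 :=
  coordMatrix_mul_transpose_of_ne hG (lineIdx_ne_four i) _ _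

theorem genMatrix_mul_lineMatrix (hG : IsElementaryAbelianTwoGroup G) (i j : Fin 3) :
    genMatrix F x i * (lineMatrix F x j)ᵀ = 0 :=
  coordMatrix_mul_transpose_of_ne hG (lineIdx_ne_four j).symm _ _

theorem sum_nonOneVec : ∑ g, nonOneVec F G g = (Fintype.card G : F) - 1 := by
  have : ∀ g : G, nonOneVec F G g = 1 - if g = 1 then 1 else 0 := fun g => by
    rw [nonOneVec]; split_ifs <;> simp
  simp [this]

theorem nonOneVec_dotProduct_self :
    nonOneVec F G ⬝ᵥ nonOneVec F G = (Fintype.card G : F) - 1 := by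
  rw [← sum_nonOneVec]
  refine Finset.sum_congr rfl fun g _ => ?_
  simp only [nonOneVec]
  split_ifs <;> simp

/-- Once one coordinate g ≠ 1 is fixed, a second one may be anything outside {1, g}: n - 2 generic
points. -/
theorem genMatrix_mul_transpose_self (hG : IsElementaryAbelianTwoGroup G) (i : Fin 3) :
    genMatrix F x i * (genMatrix F x i)ᵀ =
      ((Fintype.card G : F) - 2) • diagonal (nonOneVec F G) := by
  ext g h
  simp only [Matrix.mul_apply, genMatrix, coordMatrix, Matrix.transpose_apply, Matrix.of_apply,
    classVec_four hG (ne_add_one i)]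
  rw [sum_relCoord hG (ne_add_one i) x fun a b => (if a ≠ 1 ∧ b ≠ 1 ∧ a ≠ b then (1 : F) else 0) *
    (if a = g then 1 else 0) * ((if a ≠ 1 ∧ b ≠ 1 ∧ a ≠ b then 1 else 0) * if a = h then 1 else 0)]
  rw [Finset.sum_eq_single g]
  · have e : ∀ b : G, (if g ≠ 1 ∧ b ≠ 1 ∧ g ≠ b then (1 : F) else 0) * (if g = g then 1 else 0) *
        ((if g ≠ 1 ∧ b ≠ 1 ∧ g ≠ b then 1 else 0) * if g = h then 1 else 0) =
        diagonal (nonOneVec F G) g h * (nonOneVec F G b - if g = b then 1 else 0) := by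
      intro b
      by_cases h1 : g = h <;> by_cases h2 : g = 1 <;> by_cases h3 : b = 1 <;>
        by_cases h4 : g = b <;> simp_all [nonOneVec]
    rw [Finset.sum_congr rfl fun b _ => e b, ← Finset.mul_sum, Finset.sum_sub_distrib,
      sum_nonOneVec, Finset.sum_ite_eq, if_pos (Finset.mem_univ _), Matrix.smul_apply, smul_eq_mul]
    ring
  · intro a _ ha
    simp [ha]
  · simp

/-- Two prescribed coordinates, distinct and nontrivial, determine exactly one generic point. -/
theorem genMatrix_mul_transpose_of_ne (hG : IsElementaryAbelianTwoGroup G) {i j : Fin 3}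
    (hij : i ≠ j) : genMatrix F x i * (genMatrix F x j)ᵀ =
      vecMulVec (nonOneVec F G) (nonOneVec F G) - diagonal (nonOneVec F G) := by
  ext g h
  simp only [Matrix.mul_apply, genMatrix, coordMatrix, Matrix.transpose_apply, Matrix.of_apply,
    classVec_four hG hij]
  rw [sum_relCoord hG hij x fun a b => (if a ≠ 1 ∧ b ≠ 1 ∧ a ≠ b then (1 : F) else 0) *
    (if a = g then 1 else 0) * ((if a ≠ 1 ∧ b ≠ 1 ∧ a ≠ b then 1 else 0) * if b = h then 1 else 0)]
  rw [Finset.sum_eq_single g, Finset.sum_eq_single h]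
  · simp only [nonOneVec, Matrix.sub_apply, diagonal_apply, vecMulVec_apply]
    split_ifs <;> simp_all
  · intro b _ hb
    simp [hb]
  · simp
  · intro a _ ha
    simp [ha]
  · simp

theorem lineMatrix_mulVec (hG : IsElementaryAbelianTwoGroup G) (i : Fin 3) (c : Fin (4 + 1)) :
    lineMatrix F x i *ᵥ classVec F x c = if lineIdx i = c then nonOneVec F G else 0 := by
  ext g
  simp only [Matrix.mulVec, dotProduct, lineMatrix, coordMatrix, Matrix.of_apply,
    mul_right_comm (classVec F x _ _), classVec_mul hG]
  split_ifs with h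
  · simp only [classVec_line hG (ne_add_one i)]
    rw [sum_relCoord hG (ne_add_one i) x fun a b => (if a = 1 ∧ b ≠ 1 then (1 : F) else 0) *
      (if b = g then 1 else 0), Finset.sum_eq_single 1, Finset.sum_eq_single g]
    · simp only [nonOneVec]
      split_ifs <;> simp_all
    · intro b _ hb
      simp [hb]
    · simp
    · intro a _ ha
      simp [ha]
    · simp
  · simp

theorem genMatrix_mulVec (hG : IsElementaryAbelianTwoGroup G) (i : Fin 3) (c : Fin (4 + 1)) :
    genMatrix F x i *ᵥ classVec F x c =
      if 4 = c then ((Fintype.card G : F) - 2) • nonOneVec F G else 0 := by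
  ext g
  simp only [Matrix.mulVec, dotProduct, genMatrix, coordMatrix, Matrix.of_apply,
    mul_right_comm (classVec F x _ _), classVec_mul hG]
  split_ifs with h
  · simp only [classVec_four hG (ne_add_one i)]
    rw [sum_relCoord hG (ne_add_one i) x fun a b =>
      (if a ≠ 1 ∧ b ≠ 1 ∧ a ≠ b then (1 : F) else 0) * (if a = g then 1 else 0),
      Finset.sum_eq_single g]
    · have e : ∀ b : G, (if g ≠ 1 ∧ b ≠ 1 ∧ g ≠ b then (1 : F) else 0) *
          (if g = g then 1 else 0) =
          nonOneVec F G g * (nonOneVec F G b - if g = b then 1 else 0) := by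
        intro b
        simp only [nonOneVec]
        split_ifs <;> simp_all
      rw [Finset.sum_congr rfl fun b _ => e b, ← Finset.mul_sum, Finset.sum_sub_distrib,
        sum_nonOneVec, Finset.sum_ite_eq, if_pos (Finset.mem_univ _), Pi.smul_apply, smul_eq_mul]
      ring
    · intro a _ ha
      simp [ha]
    · simp
  · simp

theorem nonOneVec_vecMul_coordMatrix {c : Fin (4 + 1)} {j : Fin 3}
    (h : ∀ z, cayleyScheme G c x z → relCoord x z j ≠ 1) :
    nonOneVec F G ᵥ* coordMatrix F x c j = classVec F x c := by
  ext z
  simp only [Matrix.vecMul, dotProduct, coordMatrix, Matrix.of_apply, mul_left_comm (nonOneVec F G _)]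
  rw [← Finset.mul_sum]
  by_cases hz : cayleyScheme G c x z
  · simp [nonOneVec, h z hz]
  · simp [classVec, hz]

theorem nonOneVec_vecMul_lineMatrix (hG : IsElementaryAbelianTwoGroup G) (i : Fin 3) :
    nonOneVec F G ᵥ* lineMatrix F x i = classVec F x (lineIdx i) :=
  nonOneVec_vecMul_coordMatrix fun z hz => ((cayleyScheme_succ_iff hG (ne_add_one i) x z).1 hz).2

theorem nonOneVec_vecMul_genMatrix (hG : IsElementaryAbelianTwoGroup G) (i : Fin 3) :
    nonOneVec F G ᵥ* genMatrix F x i = classVec F x 4 :=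
  nonOneVec_vecMul_coordMatrix fun z hz => ((cayleyScheme_four_iff hG (ne_add_one i) x z).1 hz).1

theorem diagonal_mul_coordMatrix {c : Fin (4 + 1)} {j : Fin 3}
    (h : ∀ z, cayleyScheme G c x z → relCoord x z j ≠ 1) :
    diagonal (nonOneVec F G) * coordMatrix F x c j = coordMatrix F x c j := by
  ext g z
  simp only [Matrix.diagonal_mul, coordMatrix, Matrix.of_apply]
  by_cases hz : cayleyScheme G c x z
  · have := h z hz
    simp only [nonOneVec]
    split_ifs <;> simp_all
  · simp [classVec, hz]

theorem diagonal_mul_lineMatrix (hG : IsElementaryAbelianTwoGroup G) (i : Fin 3) :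
    diagonal (nonOneVec F G) * lineMatrix F x i = lineMatrix F x i :=
  diagonal_mul_coordMatrix fun z hz => ((cayleyScheme_succ_iff hG (ne_add_one i) x z).1 hz).2

theorem diagonal_mul_genMatrix (hG : IsElementaryAbelianTwoGroup G) (i : Fin 3) :
    diagonal (nonOneVec F G) * genMatrix F x i = genMatrix F x i :=
  diagonal_mul_coordMatrix fun z hz => ((cayleyScheme_four_iff hG (ne_add_one i) x z).1 hz).1

theorem sum_classVec_zero : ∑ z, classVec F x 0 z = 1 := by
  simp [classVec_zero]

theorem sum_classVec_line (hG : IsElementaryAbelianTwoGroup G) (i : Fin 3) :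
    ∑ z, classVec F x (lineIdx i) z = (Fintype.card G : F) - 1 := by
  simp only [classVec_line hG (ne_add_one i)]
  rw [sum_relCoord hG (ne_add_one i) x fun a b => if a = 1 ∧ b ≠ 1 then (1 : F) else 0,
    Finset.sum_eq_single 1, ← sum_nonOneVec]
  · refine Finset.sum_congr rfl fun b _ => ?_
    simp only [nonOneVec]
    split_ifs <;> simp_all
  · intro a _ ha
    simp [ha]
  · simp

theorem sum_classVec_four (hG : IsElementaryAbelianTwoGroup G) :
    ∑ z, classVec F x 4 z = ((Fintype.card G : F) - 1) * ((Fintype.card G : F) - 2) := by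
  simp only [classVec_four hG (ne_add_one 0)]
  rw [sum_relCoord hG (ne_add_one 0) x fun a b => if a ≠ 1 ∧ b ≠ 1 ∧ a ≠ b then (1 : F) else 0]
  have e : ∀ g b : G, (if g ≠ 1 ∧ b ≠ 1 ∧ g ≠ b then (1 : F) else 0) =
      nonOneVec F G g * (nonOneVec F G b - if g = b then 1 else 0) := by
    intro g b
    simp only [nonOneVec]
    split_ifs <;> simp_all
  simp only [e, ← Finset.mul_sum, Finset.sum_sub_distrib, sum_nonOneVec, Finset.sum_ite_eq,
    if_pos (Finset.mem_univ _)]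
  rw [← Finset.sum_mul, sum_nonOneVec]
  ring

theorem classVec_dotProduct (hG : IsElementaryAbelianTwoGroup G) (a c : Fin (4 + 1)) :
    classVec F x a ⬝ᵥ classVec F x c = if a = c then ∑ z, classVec F x a z else 0 := by
  simp only [dotProduct, classVec_mul hG]
  split_ifs <;> simp

end Blocks

/-! ### Generators of the Terwilliger algebra in terms of incidence matrices. -/

section Generators

variable {F : Type*} [Field F] {G : Type*} [Group G] [DecidableEq G]

variable (F) in
/-- The incidence matrices of the lines and of the generic class. -/
noncomputable def incMatrix (x : CayleyTriple G) :
    Fin 3 ⊕ Fin 3 → Matrix G (CayleyTriple G) F :=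
  Sum.elim (lineMatrix F x) (genMatrix F x)

variable {x : CayleyTriple G}

theorem dualIdempotent_eq (a : Fin (4 + 1)) :
    dualIdempotent F (cayleyScheme G) a x = diagonal (classVec F x a) := by
  ext y z
  simp only [dualIdempotent, Matrix.of_apply, diagonal_apply, classVec]
  by_cases h : y = z
  · subst h
    by_cases hy : cayleyScheme G a x y <;> simp [hy]
  · simp [h]

/-- On a given class a coordinate is either trivial everywhere or trivial nowhere. The first case
gives a rank-one matrix, the second an incidence matrix with zero row at 1; the two kinds are
therefore orthogonal. -/
theorem coordMatrix_cases (hG : IsElementaryAbelianTwoGroup G) (a : Fin (4 + 1)) (i : Fin 3) :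
    ((∃ s, coordMatrix F x a i = incMatrix F x s) ∧ ∀ z, coordMatrix F x a i 1 z = 0) ∨
      coordMatrix F x a i = vecMulVec (Pi.single 1 1) (classVec F x a) := by
  have key : (∀ z, cayleyScheme G a x z → relCoord x z i = 1) →
      coordMatrix F x a i = vecMulVec (Pi.single 1 1) (classVec F x a) := by
    intro h
    ext g z
    by_cases hz : cayleyScheme G a x z
    · simp [coordMatrix, vecMulVec_apply, h z hz, Pi.single_apply, eq_comm]
    · simp [coordMatrix, vecMulVec_apply, classVec, hz]
  have key' : (∀ z, cayleyScheme G a x z → relCoord x z i ≠ 1) →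
      ∀ z, coordMatrix F x a i 1 z = 0 := by
    intro h z
    by_cases hz : cayleyScheme G a x z
    · simp [coordMatrix, h z hz]
    · simp [coordMatrix, classVec, hz]
  rcases fin_five_cases a with rfl | ⟨j, rfl⟩ | rfl
  · refine Or.inr (key fun z hz => ?_)
    rw [cayleyScheme_zero] at hz
    rw [← hz, relCoord_self]
  · by_cases h : j = i
    · subst h
      exact Or.inr (key fun z hz => ((cayleyScheme_succ_iff hG (ne_add_one j) x z).1 hz).1)
    · exact Or.inl ⟨⟨Sum.inl j, coordMatrix_line hG h⟩,
        key' fun z hz => ((cayleyScheme_succ_iff hG h x z).1 hz).2⟩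
  · exact Or.inl ⟨⟨Sum.inr i, rfl⟩,
      key' fun z hz => ((cayleyScheme_four_iff hG (ne_add_one i) x z).1 hz).1⟩

variable [Fintype G]

variable (F) in
/-- The generators `E_a*(x) A_b E_c*(x)` of the Terwilliger algebra. -/
noncomputable def terwilligerGen (x : CayleyTriple G) (a b c : Fin (4 + 1)) :
    Matrix (CayleyTriple G) (CayleyTriple G) F :=
  dualIdempotent F (cayleyScheme G) a x * adjacencyMatrix F (cayleyScheme G) b *
    dualIdempotent F (cayleyScheme G) c x

theorem terwilligerGen_apply (a b c : Fin (4 + 1)) (y z : CayleyTriple G) :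
    terwilligerGen F x a b c y z = classVec F x a y * classVec F y b z * classVec F x c z := by
  rw [terwilligerGen, dualIdempotent_eq, dualIdempotent_eq, Matrix.mul_diagonal,
    Matrix.diagonal_mul]
  rfl

theorem sum_terwilligerGen (hG : IsElementaryAbelianTwoGroup G) (a c : Fin (4 + 1)) :
    ∑ b, terwilligerGen F x a b c = vecMulVec (classVec F x a) (classVec F x c) := by
  ext y z
  simp only [Matrix.sum_apply, terwilligerGen_apply, vecMulVec_apply]
  rw [← Finset.sum_mul, ← Finset.mul_sum, sum_classVec hG, mul_one]

theorem terwilligerGen_zero (hG : IsElementaryAbelianTwoGroup G) (a c : Fin (4 + 1)) :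
    terwilligerGen F x a 0 c = if a = c then diagonal (classVec F x a) else 0 := by
  ext y z
  rw [terwilligerGen_apply, classVec_zero]
  split_ifs with h1 h2 h2
  · rw [h1, mul_one, classVec_mul hG, if_pos h2, diagonal_apply_eq]
  · rw [h1, mul_one, classVec_mul hG, if_neg h2, Matrix.zero_apply]
  · simp [h1]
  · simp

theorem transpose_coordMatrix_mul_apply (a c : Fin (4 + 1)) (i j : Fin 3) (y z : CayleyTriple G) :
    ((coordMatrix F x a i)ᵀ * coordMatrix F x c j) y z =
      classVec F x a y * classVec F x c z * if relCoord x y i = relCoord x z j then 1 else 0 := by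
  simp [Matrix.mul_apply, coordMatrix, eq_comm]

/-- Agreeing in coordinate i means being related by the i-th line relation or being equal. -/
theorem terwilligerGen_line (a c : Fin (4 + 1)) (i : Fin 3) :
    terwilligerGen F x a (lineIdx i) c =
      (coordMatrix F x a i)ᵀ * coordMatrix F x c i - terwilligerGen F x a 0 c := by
  ext y z
  rw [Matrix.sub_apply, transpose_coordMatrix_mul_apply, terwilligerGen_apply,
    terwilligerGen_apply, classVec_zero]
  have : classVec F y (lineIdx i) z =
      (if relCoord x y i = relCoord x z i then 1 else 0) - if y = z then 1 else 0 := by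
    simp only [classVec, cayleyScheme_succ, relCoord_inj]
    by_cases h : y = z
    · simp [h]
    · simp [h]
  rw [this]
  ring

theorem transpose_lineMatrix_mul_self (hG : IsElementaryAbelianTwoGroup G) (i : Fin 3) :
    (lineMatrix F x i)ᵀ * lineMatrix F x i = diagonal (classVec F x (lineIdx i)) := by
  ext y z
  rw [lineMatrix, transpose_coordMatrix_mul_apply, diagonal_apply]
  split_ifs with h1 h2 h2
  · rw [mul_one, h2, classVec_mul hG, if_pos rfl]
  · by_cases hy : cayleyScheme G (lineIdx i) x y
    · by_cases hz : cayleyScheme G (lineIdx i) x z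
      · rw [cayleyScheme_succ_iff hG (ne_add_one i)] at hy hz
        exact absurd (ext_of_relCoord hG (ne_add_one i) (hy.1.trans hz.1.symm) h1) h2
      · simp [classVec, hz]
    · simp [classVec, hy]
  · exact absurd (by rw [h2]) h1
  · rw [mul_zero]

/-- The generators lie in the span of the all-one blocks, the products of incidence matrices
and one diagonal idempotent. -/
theorem terwilligerGen_mem (hG : IsElementaryAbelianTwoGroup G)
    (S : Submodule F (Matrix (CayleyTriple G) (CayleyTriple G) F))
    (hJ : ∀ a c, vecMulVec (classVec F x a) (classVec F x c) ∈ S)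
    (hQ : ∀ s t, (incMatrix F x s)ᵀ * incMatrix F x t ∈ S)
    (h4 : diagonal (classVec F x 4) ∈ S) (a b c : Fin (4 + 1)) :
    terwilligerGen F x a b c ∈ S := by
  have h0 : ∀ a c, terwilligerGen F x a 0 c ∈ S := by
    intro a c
    rw [terwilligerGen_zero hG]
    split_ifs with h
    · rcases fin_five_cases a with rfl | ⟨i, rfl⟩ | rfl
      · convert hJ 0 0 using 1
        ext y z
        simp only [diagonal_apply, vecMulVec_apply, classVec_zero]
        split_ifs <;> simp_all
      · rw [← transpose_lineMatrix_mul_self hG]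
        exact hQ (Sum.inl i) (Sum.inl i)
      · exact h4
    · exact S.zero_mem
  have hl : ∀ i a c, terwilligerGen F x a (lineIdx i) c ∈ S := by
    intro i a c
    rw [terwilligerGen_line]
    refine S.sub_mem ?_ (h0 a c)
    rcases coordMatrix_cases (F := F) (x := x) hG a i with ⟨⟨s, hs⟩, hs'⟩ | ha <;>
      rcases coordMatrix_cases (F := F) (x := x) hG c i with ⟨⟨t, ht⟩, ht'⟩ | hc
    · rw [hs, ht]
      exact hQ s t
    · convert S.zero_mem
      ext y z
      simp [hc, Matrix.mul_apply, vecMulVec_apply, Pi.single_apply, hs']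
    · convert S.zero_mem
      ext y z
      simp [ha, Matrix.mul_apply, vecMulVec_apply, Pi.single_apply, ht']
    · convert hJ a c using 1
      ext y z
      simp [ha, hc, Matrix.mul_apply, vecMulVec_apply, Pi.single_apply]
  rcases fin_five_cases b with rfl | ⟨i, rfl⟩ | rfl
  · exact h0 a c
  · exact hl i a c
  -- The relations partition all pairs, so the last block is the all-one block minus the other four.
  · have e : terwilligerGen F x a 4 c = vecMulVec (classVec F x a) (classVec F x c) -
        (terwilligerGen F x a 0 c + terwilligerGen F x a (lineIdx 0) c +
          terwilligerGen F x a (lineIdx 1) c + terwilligerGen F x a (lineIdx 2) c) := by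
      rw [← sum_terwilligerGen hG, Fin.sum_univ_five, eq_sub_iff_add_eq, add_comm]
      rfl
    rw [e]
    exact S.sub_mem (hJ a c) (S.add_mem (S.add_mem (S.add_mem (h0 a c) (hl 0 a c)) (hl 1 a c))
      (hl 2 a c))

theorem terwilligerGen_mem_terwilligerAlgebra (a b c : Fin (4 + 1)) :
    terwilligerGen F x a b c ∈ terwilligerAlgebra F (cayleyScheme G) x :=
  Algebra.subset_adjoin ⟨a, b, c, rfl⟩

theorem terwilligerAlgebra_le {S : Subalgebra F (Matrix (CayleyTriple G) (CayleyTriple G) F)}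
    (h : ∀ a b c, terwilligerGen F x a b c ∈ S) :
    terwilligerAlgebra F (cayleyScheme G) x ≤ S := by
  refine Algebra.adjoin_le ?_
  rintro _ ⟨a, b, c, rfl⟩
  exact h a b c

theorem vecMulVec_mem_terwilligerAlgebra (hG : IsElementaryAbelianTwoGroup G)
    (a c : Fin (4 + 1)) :
    vecMulVec (classVec F x a) (classVec F x c) ∈ terwilligerAlgebra F (cayleyScheme G) x := by
  rw [← sum_terwilligerGen hG]
  exact sum_mem fun b _ => terwilligerGen_mem_terwilligerAlgebra a b c

theorem exists_ne_ne (i j : Fin 3) : ∃ k, i ≠ k ∧ j ≠ k := by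
  revert i j
  decide

/-- The line relations directly give products comparing the same coordinate in two classes. The
remaining products, such as L_iᵀ N_i and N_iᵀ N_j, come from inserting L_k L_kᵀ = D in the middle,
since D fixes every incidence matrix. -/
theorem incMatrix_mem_terwilligerAlgebra (hG : IsElementaryAbelianTwoGroup G)
    (s t : Fin 3 ⊕ Fin 3) :
    (incMatrix F x s)ᵀ * incMatrix F x t ∈ terwilligerAlgebra F (cayleyScheme G) x := by
  have W : ∀ a c i, (coordMatrix F x a i)ᵀ * coordMatrix F x c i ∈
      terwilligerAlgebra F (cayleyScheme G) x := by
    intro a c i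
    have e := terwilligerGen_line (F := F) (x := x) a c i
    rw [eq_sub_iff_add_eq] at e
    rw [← e]
    exact add_mem (terwilligerGen_mem_terwilligerAlgebra _ _ _)
      (terwilligerGen_mem_terwilligerAlgebra _ _ _)
  have ll : ∀ i j, (lineMatrix F x i)ᵀ * lineMatrix F x j ∈
      terwilligerAlgebra F (cayleyScheme G) x := by
    intro i j
    obtain ⟨k, hi, hj⟩ := exists_ne_ne i j
    rw [← coordMatrix_line hG hi, ← coordMatrix_line hG hj]
    exact W _ _ k
  have assoc : ∀ (A B : Matrix G (CayleyTriple G) F) (k : Fin 3),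
      diagonal (nonOneVec F G) * B = B →
      Aᵀ * lineMatrix F x k * ((lineMatrix F x k)ᵀ * B) = Aᵀ * B := by
    intro A B k hB
    rw [Matrix.mul_assoc, ← Matrix.mul_assoc (lineMatrix F x k),
      lineMatrix_mul_transpose_self hG, hB]
  have lg' : ∀ i j, i ≠ j → (lineMatrix F x i)ᵀ * genMatrix F x j ∈
      terwilligerAlgebra F (cayleyScheme G) x := by
    intro i j h
    rw [← coordMatrix_line hG h]
    exact W _ _ j
  have gl' : ∀ i j, i ≠ j → (genMatrix F x j)ᵀ * lineMatrix F x i ∈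
      terwilligerAlgebra F (cayleyScheme G) x := by
    intro i j h
    rw [← coordMatrix_line hG h]
    exact W _ _ j
  have lg : ∀ i j, (lineMatrix F x i)ᵀ * genMatrix F x j ∈
      terwilligerAlgebra F (cayleyScheme G) x := by
    intro i j
    obtain ⟨k, -, hk⟩ := exists_ne_ne i j
    rw [← assoc _ _ k (diagonal_mul_genMatrix hG j)]
    exact mul_mem (ll _ _) (lg' _ _ hk.symm)
  have gl : ∀ i j, (genMatrix F x j)ᵀ * lineMatrix F x i ∈
      terwilligerAlgebra F (cayleyScheme G) x := by
    intro i j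
    obtain ⟨k, -, hk⟩ := exists_ne_ne i j
    rw [← assoc _ _ k (diagonal_mul_lineMatrix hG i)]
    exact mul_mem (gl' _ _ hk.symm) (ll _ _)
  rcases s with i | i <;> rcases t with j | j
  · exact ll i j
  · exact lg i j
  · exact gl j i
  · change (genMatrix F x i)ᵀ * genMatrix F x j ∈ _
    rw [← assoc _ _ 0 (diagonal_mul_genMatrix hG j)]
    exact mul_mem (gl _ _) (lg _ _)

end Generators

/-! ### Invariant subspaces and failure of semisimplicity. -/

/-- The matrices that map a subspace into itself. -/
def stabilizerAlgebra {F X : Type*} [Field F] [Fintype X] [DecidableEq X]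
    (V : Submodule F (X → F)) : Subalgebra F (Matrix X X F) where
  carrier := {t | ∀ v ∈ V, t *ᵥ v ∈ V}
  mul_mem' := fun {s t} hs ht v hv => by
    rw [← Matrix.mulVec_mulVec]
    exact hs _ (ht _ hv)
  add_mem' := fun {s t} hs ht v hv => by
    rw [Matrix.add_mulVec]
    exact V.add_mem (hs _ hv) (ht _ hv)
  algebraMap_mem' := fun r v hv => by
    rw [Algebra.algebraMap_eq_smul_one, Matrix.smul_mulVec, Matrix.one_mulVec]
    exact V.smul_mem _ hv

theorem mem_stabilizerAlgebra_span {F X : Type*} [Field F] [Fintype X] [DecidableEq X]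
    {s : Set (X → F)} {t : Matrix X X F} (h : ∀ v ∈ s, t *ᵥ v ∈ Submodule.span F s) :
    t ∈ stabilizerAlgebra (Submodule.span F s) := by
  intro v hv
  have : Submodule.span F s ≤ (Submodule.span F s).comap (Matrix.mulVecLin t) :=
    Submodule.span_le.2 h
  exact this hv

section NotSemisimple

variable {F : Type*} [Field F] {G : Type*} [Group G] [DecidableEq G] [Fintype G]
  {x : CayleyTriple G}

theorem terwilligerAlgebra_le_stabilizerAlgebra (hG : IsElementaryAbelianTwoGroup G)
    {V : Submodule F (CayleyTriple G → F)}
    (hJ : ∀ a c, vecMulVec (classVec F x a) (classVec F x c) ∈ stabilizerAlgebra V)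
    (hQ : ∀ s t, (incMatrix F x s)ᵀ * incMatrix F x t ∈ stabilizerAlgebra V)
    (h4 : diagonal (classVec F x 4) ∈ stabilizerAlgebra V) :
    terwilligerAlgebra F (cayleyScheme G) x ≤ stabilizerAlgebra V :=
  terwilligerAlgebra_le
    (terwilligerGen_mem hG (Subalgebra.toSubmodule (stabilizerAlgebra V)) hJ hQ h4)

theorem exists_incMatrix_mulVec (hG : IsElementaryAbelianTwoGroup G) (s : Fin 3 ⊕ Fin 3)
    (c : Fin (4 + 1)) : ∃ r : F, incMatrix F x s *ᵥ classVec F x c = r • nonOneVec F G := by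
  rcases s with i | i
  · refine ⟨if lineIdx i = c then 1 else 0, ?_⟩
    rw [incMatrix, Sum.elim_inl, lineMatrix_mulVec hG]
    split_ifs <;> simp
  · refine ⟨if 4 = c then (Fintype.card G : F) - 2 else 0, ?_⟩
    rw [incMatrix, Sum.elim_inr, genMatrix_mulVec hG]
    split_ifs <;> simp

theorem exists_nonOneVec_vecMul_incMatrix (hG : IsElementaryAbelianTwoGroup G)
    (s : Fin 3 ⊕ Fin 3) : ∃ c, nonOneVec F G ᵥ* incMatrix F x s = classVec F x c := by
  rcases s with i | i
  · exact ⟨_, nonOneVec_vecMul_lineMatrix hG i⟩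
  · exact ⟨_, nonOneVec_vecMul_genMatrix hG i⟩

theorem exists_incMatrix_mul_transpose (hG : IsElementaryAbelianTwoGroup G)
    (s t : Fin 3 ⊕ Fin 3) : ∃ r r' : F, incMatrix F x s * (incMatrix F x t)ᵀ =
      r • diagonal (nonOneVec F G) + r' • vecMulVec (nonOneVec F G) (nonOneVec F G) := by
  rcases s with i | i <;> rcases t with j | j
  · refine ⟨if i = j then 1 else 0, 0, ?_⟩
    simp only [incMatrix, Sum.elim_inl, lineMatrix_mul_transpose hG]
    split_ifs <;> simp
  · exact ⟨0, 0, by simp [incMatrix, lineMatrix_mul_genMatrix hG]⟩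
  · exact ⟨0, 0, by simp [incMatrix, genMatrix_mul_lineMatrix hG]⟩
  · simp only [incMatrix, Sum.elim_inr]
    by_cases h : i = j
    · refine ⟨(Fintype.card G : F) - 2, 0, ?_⟩
      rw [h, genMatrix_mul_transpose_self hG, zero_smul, add_zero]
    · exact ⟨-1, 1, by rw [genMatrix_mul_transpose_of_ne hG h]; simp [sub_eq_neg_add]⟩

theorem diagonal_mul_incMatrix (hG : IsElementaryAbelianTwoGroup G) (s : Fin 3 ⊕ Fin 3) :
    diagonal (nonOneVec F G) * incMatrix F x s = incMatrix F x s := by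
  rcases s with i | i
  · exact diagonal_mul_lineMatrix hG i
  · exact diagonal_mul_genMatrix hG i

theorem incMatrix_mul_diagonal (hG : IsElementaryAbelianTwoGroup G) (s : Fin 3 ⊕ Fin 3) :
    incMatrix F x s * diagonal (classVec F x 4) = incMatrix F x s ∨
      incMatrix F x s * diagonal (classVec F x 4) = 0 := by
  rcases s with i | i
  · right
    ext g z
    simp [incMatrix, lineMatrix, coordMatrix, Matrix.mul_diagonal, classVec_mul hG, lineIdx_ne_four]
  · left
    ext g z
    simp [incMatrix, genMatrix, coordMatrix, Matrix.mul_diagonal, classVec_mul hG]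

/-- An incidence matrix maps each class vector to a multiple of u, and its transpose maps u back to
a class vector. -/
theorem terwilligerAlgebra_le_stabilizer_classVec (hG : IsElementaryAbelianTwoGroup G) :
    terwilligerAlgebra F (cayleyScheme G) x ≤
      stabilizerAlgebra (Submodule.span F (Set.range (classVec F x))) := by
  refine terwilligerAlgebra_le_stabilizerAlgebra hG (fun a c => ?_) (fun s t => ?_) ?_ <;>
    refine mem_stabilizerAlgebra_span ?_ <;> rintro _ ⟨d, rfl⟩
  · rw [Matrix.vecMulVec_mulVec, op_smul_eq_smul]
    exact Submodule.smul_mem _ _ (Submodule.subset_span (Set.mem_range_self a))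
  · obtain ⟨r, hr⟩ := exists_incMatrix_mulVec (F := F) (x := x) hG t d
    obtain ⟨c, hc⟩ := exists_nonOneVec_vecMul_incMatrix (F := F) (x := x) hG s
    rw [← Matrix.mulVec_mulVec, hr, Matrix.mulVec_smul, Matrix.mulVec_transpose, hc]
    exact Submodule.smul_mem _ _ (Submodule.subset_span (Set.mem_range_self c))
  · have : diagonal (classVec F x 4) *ᵥ classVec F x d =
        (if 4 = d then (1 : F) else 0) • classVec F x 4 := by
      ext z
      rw [Matrix.mulVec_diagonal, classVec_mul hG]
      split_ifs <;> simp
    rw [this]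
    exact Submodule.smul_mem _ _ (Submodule.subset_span (Set.mem_range_self 4))

variable (F) (x) in
/-- The vectors coming from vectors on the group with coordinate sum zero. -/
def standardVecs : Set (CayleyTriple G → F) :=
  {v | ∃ s w, nonOneVec F G ⬝ᵥ w = 0 ∧ v = (incMatrix F x s)ᵀ *ᵥ w}

theorem classVec_dotProduct_standardVecs (hG : IsElementaryAbelianTwoGroup G) (c : Fin (4 + 1))
    {v : CayleyTriple G → F} (hv : v ∈ standardVecs F x) : classVec F x c ⬝ᵥ v = 0 := by
  obtain ⟨s, w, hw, rfl⟩ := hv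
  obtain ⟨r, hr⟩ := exists_incMatrix_mulVec (F := F) (x := x) hG s c
  rw [Matrix.dotProduct_mulVec, Matrix.vecMul_transpose, hr, smul_dotProduct, hw, smul_zero]

/-- For w of sum zero over G \ {1} the u uᵀ term of the Gram relations vanishes, so they act as
scalars on w; the all-one blocks act as zero. -/
theorem terwilligerAlgebra_le_stabilizer_standardVecs (hG : IsElementaryAbelianTwoGroup G) :
    terwilligerAlgebra F (cayleyScheme G) x ≤
      stabilizerAlgebra (Submodule.span F (standardVecs F x)) := by
  refine terwilligerAlgebra_le_stabilizerAlgebra hG (fun a c => ?_) (fun s t => ?_) ?_ <;>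
    refine mem_stabilizerAlgebra_span fun v hv => ?_
  · rw [Matrix.vecMulVec_mulVec, classVec_dotProduct_standardVecs hG _ hv]
    simp
  · obtain ⟨s', w, hw, rfl⟩ := hv
    obtain ⟨r, r', hr⟩ := exists_incMatrix_mul_transpose (F := F) (x := x) hG t s'
    have e : (incMatrix F x s)ᵀ * diagonal (nonOneVec F G) = (incMatrix F x s)ᵀ := by
      rw [← Matrix.diagonal_transpose, ← Matrix.transpose_mul, diagonal_mul_incMatrix hG]
    have : ((incMatrix F x s)ᵀ * incMatrix F x t) *ᵥ ((incMatrix F x s')ᵀ *ᵥ w) =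
        r • ((incMatrix F x s)ᵀ *ᵥ w) := by
      rw [Matrix.mulVec_mulVec, Matrix.mul_assoc, hr, Matrix.mul_add, Matrix.mul_smul, e,
        Matrix.add_mulVec, Matrix.smul_mulVec, ← Matrix.mulVec_mulVec, Matrix.smul_mulVec,
        Matrix.vecMulVec_mulVec, hw]
      simp
    rw [this]
    exact Submodule.smul_mem _ _ (Submodule.subset_span ⟨s, w, hw, rfl⟩)
  · obtain ⟨s, w, hw, rfl⟩ := hv
    have e : diagonal (classVec F x 4) * (incMatrix F x s)ᵀ =
        (incMatrix F x s * diagonal (classVec F x 4))ᵀ := by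
      rw [Matrix.transpose_mul, Matrix.diagonal_transpose]
    rw [Matrix.mulVec_mulVec, e]
    rcases incMatrix_mul_diagonal (F := F) (x := x) hG s with h | h
    · rw [h]
      exact Submodule.subset_span ⟨s, w, hw, rfl⟩
    · rw [h]
      simp

theorem not_isSemisimpleRing_subalgebra {A : Type*} [Ring A] [Algebra F A] {T : Subalgebra F A}
    {a : A} (haT : a ∈ T) (ha : a ≠ 0) (h : ∀ t ∈ T, a * t * a = 0) : ¬ IsSemisimpleRing T :=
  not_isSemisimpleRing_of_mul_mul_eq_zero (a := (⟨a, haT⟩ : T))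
    (fun e => ha (congrArg Subtype.val e)) fun t => Subtype.ext (h t t.2)

theorem exists_relCoord_eq (hG : IsElementaryAbelianTwoGroup G) (x : CayleyTriple G) (a b : G) :
    ∃ z : CayleyTriple G, relCoord x z 0 = a ∧ relCoord x z 1 = b ∧ relCoord x z 2 = a * b := by
  obtain ⟨z, hz⟩ := (relCoord_bijective hG (i := 0) (j := 1) (by decide) x).2 (a, b)
  simp only [Prod.mk.injEq] at hz
  exact ⟨z, hz.1, hz.2, by rw [← relCoord_mul hG, hz.1, hz.2]⟩

/-- Take a to be the all-one block e eᵀ of the generic class. T sends e into the span of the class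
vectors, all of which are orthogonal to e because its norm (n - 1)(n - 2) is zero in F. Hence aTa =
0. -/
theorem not_isSemisimpleRing_of_card_sub_mul_eq_zero (hG : IsElementaryAbelianTwoGroup G)
    (hn : 3 ≤ Fintype.card G) (h : ((Fintype.card G : F) - 1) * ((Fintype.card G : F) - 2) = 0) :
    ¬ IsSemisimpleRing (terwilligerAlgebra F (cayleyScheme G) x) := by
  refine not_isSemisimpleRing_subalgebra (vecMulVec_mem_terwilligerAlgebra hG 4 4) ?_ ?_
  · obtain ⟨a, ha⟩ : ∃ a : G, a ∉ ({1} : Finset G) :=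
      Finset.exists_mem_notMem_of_card_lt_card (s := {1}) (t := Finset.univ)
        (by rw [Finset.card_univ, Finset.card_singleton]; omega) |>.imp fun _ h => h.2
    obtain ⟨b, hb⟩ : ∃ b : G, b ∉ ({1, a} : Finset G) :=
      Finset.exists_mem_notMem_of_card_lt_card (s := {1, a}) (t := Finset.univ)
        (by rw [Finset.card_univ]; exact Finset.card_le_two.trans_lt hn) |>.imp fun _ h => h.2
    simp only [Finset.mem_insert, Finset.mem_singleton, not_or] at ha hb
    obtain ⟨z, h0, h1, -⟩ := exists_relCoord_eq hG x a b
    intro e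
    have := congrFun (congrFun e z) z
    rw [vecMulVec_apply, classVec_four hG (i := 0) (j := 1) (by decide), h0, h1,
      if_pos ⟨ha, hb.1, Ne.symm hb.2⟩] at this
    simp at this
  · intro t ht
    have h1 := terwilligerAlgebra_le_stabilizer_classVec hG ht _
      (Submodule.subset_span (Set.mem_range_self (f := classVec F x) 4))
    have h2 : ∀ v ∈ Submodule.span F (Set.range (classVec F x)), classVec F x 4 ⬝ᵥ v = 0 := by
      intro v hv
      induction hv using Submodule.span_induction with
      | mem v hv =>
        obtain ⟨c, rfl⟩ := hv
        rw [classVec_dotProduct hG, sum_classVec_four hG, h, ite_self]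
      | zero => simp
      | add v w _ _ hv hw => rw [dotProduct_add, hv, hw, add_zero]
      | smul r v _ hv => rw [dotProduct_smul, hv, smul_zero]
    rw [Matrix.mul_assoc, Matrix.mul_vecMulVec, Matrix.vecMulVec_mul_vecMulVec, h2 _ h1]
    simp

variable (F) (x) in
/-- The sum of the incidence matrices of the generic class. -/
noncomputable def genSum : Matrix G (CayleyTriple G) F :=
  genMatrix F x 0 + genMatrix F x 1 + genMatrix F x 2

theorem genSum_mul_transpose_genMatrix (hG : IsElementaryAbelianTwoGroup G) (i : Fin 3) :
    genSum F x * (genMatrix F x i)ᵀ = ((Fintype.card G : F) - 4) • diagonal (nonOneVec F G) +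
      (2 : F) • vecMulVec (nonOneVec F G) (nonOneVec F G) := by
  have e : ((Fintype.card G : F) - 4) • diagonal (nonOneVec F G) =
      ((Fintype.card G : F) - 2) • diagonal (nonOneVec F G) - (2 : F) • diagonal (nonOneVec F G) := by
    rw [← sub_smul]
    congr 1
    ring
  have h := fun j => genMatrix_mul_transpose_of_ne (F := F) (x := x) hG (i := j) (j := i)
  rw [genSum, Matrix.add_mul, Matrix.add_mul, e, two_smul, two_smul]
  have hi : i = 0 ∨ i = 1 ∨ i = 2 := by
    clear h
    revert i
    decide
  rcases hi with rfl | rfl | rfl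
  · rw [genMatrix_mul_transpose_self hG, h 1 (by decide), h 2 (by decide)]
    abel
  · rw [genMatrix_mul_transpose_self hG, h 0 (by decide), h 2 (by decide)]
    abel
  · rw [genMatrix_mul_transpose_self hG, h 0 (by decide), h 1 (by decide)]
    abel

theorem genSum_mul_transpose_lineMatrix (hG : IsElementaryAbelianTwoGroup G) (i : Fin 3) :
    genSum F x * (lineMatrix F x i)ᵀ = 0 := by
  simp [genSum, Matrix.add_mul, genMatrix_mul_lineMatrix hG]

theorem nonOneVec_vecMul_genSum (hG : IsElementaryAbelianTwoGroup G) :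
    nonOneVec F G ᵥ* genSum F x = (3 : F) • classVec F x 4 := by
  simp only [genSum, Matrix.vecMul_add, nonOneVec_vecMul_genMatrix hG]
  module

/-- With S = N_0 + N_1 + N_2 and e the generic class vector, take a = 3 SᵀS - 9 e eᵀ. Its image lies
in the T-stable span of `standardVecs`, because Sᵀu = 3e and u·u = 3. It kills that span, because S
N_iᵀ is n - 4 = 0 times D there. Hence aTa = 0. -/
theorem not_isSemisimpleRing_of_card_eq_four (hG : IsElementaryAbelianTwoGroup G)
    (hn : 4 < Fintype.card G) (h : (Fintype.card G : F) = 4) (hF2 : (2 : F) ≠ 0)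
    (hF3 : (3 : F) ≠ 0) : ¬ IsSemisimpleRing (terwilligerAlgebra F (cayleyScheme G) x) := by
  have hdot : nonOneVec F G ⬝ᵥ nonOneVec F G = 3 := by
    rw [nonOneVec_dotProduct_self, h]
    norm_num
  set a : Matrix (CayleyTriple G) (CayleyTriple G) F :=
    (3 : F) • ((genSum F x)ᵀ * genSum F x) - (9 : F) • vecMulVec (classVec F x 4) (classVec F x 4)
    with ha
  have hav : ∀ v, a *ᵥ v = (genSum F x)ᵀ *ᵥ
      ((3 : F) • (genSum F x *ᵥ v) - ((3 : F) * (classVec F x 4 ⬝ᵥ v)) • nonOneVec F G) := by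
    intro v
    rw [ha, Matrix.sub_mulVec, Matrix.smul_mulVec, Matrix.smul_mulVec, Matrix.vecMulVec_mulVec,
      ← Matrix.mulVec_mulVec, Matrix.mulVec_sub, Matrix.mulVec_smul, Matrix.mulVec_smul,
      Matrix.mulVec_transpose _ (nonOneVec F G), nonOneVec_vecMul_genSum hG, smul_smul]
    congr 1
    ext z
    simp
    ring
  have hstd : ∀ v, a *ᵥ v ∈ Submodule.span F (standardVecs F x) := by
    intro v
    rw [hav]
    have hw : nonOneVec F G ⬝ᵥ ((3 : F) • (genSum F x *ᵥ v) -
        ((3 : F) * (classVec F x 4 ⬝ᵥ v)) • nonOneVec F G) = 0 := by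
      rw [dotProduct_sub, dotProduct_smul, dotProduct_smul, Matrix.dotProduct_mulVec,
        nonOneVec_vecMul_genSum hG, smul_dotProduct, hdot]
      simp only [smul_eq_mul]
      ring
    rw [genSum, Matrix.transpose_add, Matrix.transpose_add, Matrix.add_mulVec, Matrix.add_mulVec,
      ← genSum]
    exact Submodule.add_mem _ (Submodule.add_mem _
      (Submodule.subset_span ⟨Sum.inr 0, _, hw, rfl⟩)
      (Submodule.subset_span ⟨Sum.inr 1, _, hw, rfl⟩))
      (Submodule.subset_span ⟨Sum.inr 2, _, hw, rfl⟩)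
  have hkill : ∀ v ∈ Submodule.span F (standardVecs F x), a *ᵥ v = 0 := by
    intro v hv
    induction hv using Submodule.span_induction with
    | mem v hv =>
      rw [hav, classVec_dotProduct_standardVecs hG _ hv]
      obtain ⟨s, w, hw, rfl⟩ := hv
      have : genSum F x *ᵥ ((incMatrix F x s)ᵀ *ᵥ w) = 0 := by
        rw [Matrix.mulVec_mulVec]
        rcases s with i | i
        · rw [incMatrix, Sum.elim_inl, genSum_mul_transpose_lineMatrix hG, Matrix.zero_mulVec]
        · rw [incMatrix, Sum.elim_inr, genSum_mul_transpose_genMatrix hG, h, sub_self, zero_smul,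
            zero_add, Matrix.smul_mulVec, Matrix.vecMulVec_mulVec, hw]
          simp
      rw [this]
      simp
    | zero => simp
    | add v w _ _ hv hw => rw [Matrix.mulVec_add, hv, hw, add_zero]
    | smul r v _ hv => rw [Matrix.mulVec_smul, hv, smul_zero]
  refine not_isSemisimpleRing_subalgebra (a := a) ?_ ?_ ?_
  · have hQ := fun i j => incMatrix_mem_terwilligerAlgebra (F := F) (x := x) hG (Sum.inr i)
      (Sum.inr j)
    refine sub_mem (Subalgebra.smul_mem _ ?_ _)
      (Subalgebra.smul_mem _ (vecMulVec_mem_terwilligerAlgebra hG 4 4) _)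
    simp only [genSum, Matrix.transpose_add, Matrix.add_mul, Matrix.mul_add]
    exact add_mem (add_mem (add_mem (add_mem (hQ 0 0) (hQ 1 0)) (hQ 2 0))
      (add_mem (add_mem (hQ 0 1) (hQ 1 1)) (hQ 2 1)))
      (add_mem (add_mem (hQ 0 2) (hQ 1 2)) (hQ 2 2))
  · obtain ⟨g, hg⟩ : ∃ g : G, g ∉ ({1} : Finset G) :=
      Finset.exists_mem_notMem_of_card_lt_card (s := {1}) (t := Finset.univ)
        (by rw [Finset.card_univ, Finset.card_singleton]; omega) |>.imp fun _ h => h.2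
    obtain ⟨b, hb⟩ : ∃ b : G, b ∉ ({1, g} : Finset G) :=
      Finset.exists_mem_notMem_of_card_lt_card (s := {1, g}) (t := Finset.univ)
        (by rw [Finset.card_univ]; exact Finset.card_le_two.trans_lt (by omega))
        |>.imp fun _ h => h.2
    -- Here |G| > 4 is used. The coordinates (g, b, gb) and (g, c, gc) then match in just one of the
    -- nine comparisons, so the corresponding entry of a is 3 - 9 = -6.
    obtain ⟨c, hc⟩ : ∃ c : G, c ∉ ({1, g, b, g * b} : Finset G) :=
      Finset.exists_mem_notMem_of_card_lt_card (s := {1, g, b, g * b}) (t := Finset.univ)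
        (by rw [Finset.card_univ]; exact Finset.card_le_four.trans_lt hn)
        |>.imp fun _ h => h.2
    simp only [Finset.mem_insert, Finset.mem_singleton, not_or] at hg hb hc
    obtain ⟨hb1, hbg⟩ := hb
    obtain ⟨hc1, hcg, hcb, hcgb⟩ := hc
    obtain ⟨y, y0, y1, y2⟩ := exists_relCoord_eq hG x g b
    obtain ⟨z, z0, z1, z2⟩ := exists_relCoord_eq hG x g c
    have cy : classVec F x 4 y = 1 := by
      rw [classVec_four hG (i := 0) (j := 1) (by decide), y0, y1, if_pos ⟨hg, hb1, Ne.symm hbg⟩]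
    have cz : classVec F x 4 z = 1 := by
      rw [classVec_four hG (i := 0) (j := 1) (by decide), z0, z1, if_pos ⟨hg, hc1, Ne.symm hcg⟩]
    have e1 : b ≠ g * c := by
      rintro rfl
      exact hcgb (by rw [← mul_assoc, hG.mul_self, one_mul])
    intro e
    have e2 := congrFun (congrFun e y) z
    rw [ha, Matrix.sub_apply, Matrix.smul_apply, Matrix.smul_apply, vecMulVec_apply, cy, cz] at e2
    simp only [genSum, Matrix.transpose_add, Matrix.add_mul, Matrix.mul_add, Matrix.add_apply,
      genMatrix, transpose_coordMatrix_mul_apply, cy, cz, y0, y1, y2, z0, z1, z2] at e2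
    simp [hb1, hbg, hc1, Ne.symm hcg, Ne.symm hcb, Ne.symm hcgb, e1] at e2
    have : (2 : F) * 3 = 0 := by linear_combination -e2
    exact mul_ne_zero hF2 hF3 this
  · intro t ht
    have : ∀ v, (a * t * a) *ᵥ v = 0 := by
      intro v
      rw [← Matrix.mulVec_mulVec, ← Matrix.mulVec_mulVec]
      exact hkill _ (terwilligerAlgebra_le_stabilizer_standardVecs hG ht _ (hstd v))
    exact Matrix.ext_of_mulVec_single fun i => by rw [this, Matrix.zero_mulVec]

end NotSemisimple

/-! ### Orthogonal decomposition and semisimplicity. -/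

theorem transpose_mul_mem_of_mem_span {F X κ : Type*} [Field F] [Fintype κ]
    {S : Submodule F (Matrix X X F)} {s : Set (Matrix κ X F)} (h : ∀ v ∈ s, ∀ w ∈ s, vᵀ * w ∈ S)
    {v w : Matrix κ X F} (hv : v ∈ Submodule.span F s) (hw : w ∈ Submodule.span F s) :
    vᵀ * w ∈ S := by
  induction hv, hw using Submodule.span_induction₂ with
  | mem_mem v w hv hw => exact h v hv w hw
  | zero_left w _ => simp
  | zero_right v _ => simp
  | add_left u v w _ _ _ hu hv =>
    rw [Matrix.transpose_add, Matrix.add_mul]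
    exact S.add_mem hu hv
  | add_right u v w _ _ _ hu hv =>
    rw [Matrix.mul_add]
    exact S.add_mem hu hv
  | smul_left r u v _ _ hu =>
    rw [Matrix.transpose_smul, Matrix.smul_mul]
    exact S.smul_mem _ hu
  | smul_right r u v _ _ hu =>
    rw [Matrix.mul_smul]
    exact S.smul_mem _ hu

section Semisimple

variable (F : Type*) [Field F] (G : Type*) [Group G] [DecidableEq G] [Fintype G]

/-- The projection onto the vectors that vanish at the identity and have coordinate sum zero. -/
noncomputable def stdProj : Matrix G G F :=
  diagonal (nonOneVec F G) -
    ((Fintype.card G : F) - 1)⁻¹ • vecMulVec (nonOneVec F G) (nonOneVec F G)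

variable {F} {G} {x : CayleyTriple G}

theorem stdProj_transpose : (stdProj F G)ᵀ = stdProj F G := by
  rw [stdProj, Matrix.transpose_sub, Matrix.transpose_smul, Matrix.diagonal_transpose,
    Matrix.transpose_vecMulVec]

theorem stdProj_mulVec_nonOneVec (h1 : (Fintype.card G : F) - 1 ≠ 0) :
    stdProj F G *ᵥ nonOneVec F G = 0 := by
  rw [stdProj, Matrix.sub_mulVec, Matrix.smul_mulVec, Matrix.vecMulVec_mulVec, op_smul_eq_smul,
    nonOneVec_dotProduct_self, smul_smul, inv_mul_cancel₀ h1, one_smul, sub_eq_zero]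
  ext g
  simp only [Matrix.mulVec_diagonal, nonOneVec]
  split_ifs <;> simp

theorem stdProj_mul_diagonal : stdProj F G * diagonal (nonOneVec F G) = stdProj F G := by
  ext g h
  simp only [stdProj, Matrix.mul_diagonal, Matrix.sub_apply, Matrix.smul_apply, diagonal_apply,
    vecMulVec_apply, nonOneVec]
  split_ifs <;> simp_all

theorem stdProj_mul_vecMulVec (h1 : (Fintype.card G : F) - 1 ≠ 0) {X : Type*} (v : X → F) :
    stdProj F G * vecMulVec (nonOneVec F G) v = 0 := by
  rw [Matrix.mul_vecMulVec, stdProj_mulVec_nonOneVec h1]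
  simp

theorem stdProj_mul_self (h1 : (Fintype.card G : F) - 1 ≠ 0) :
    stdProj F G * stdProj F G = stdProj F G := by
  nth_rewrite 2 [stdProj]
  rw [Matrix.mul_sub, Matrix.mul_smul, stdProj_mul_diagonal, stdProj_mul_vecMulVec h1, smul_zero,
    sub_zero]

variable (F) (x) in
/-- The incidence matrices projected onto the standard part. -/
noncomputable def stdMatrix (s : Fin 3 ⊕ Fin 3) : Matrix G (CayleyTriple G) F :=
  stdProj F G * incMatrix F x s

theorem stdProj_mul_stdMatrix (h1 : (Fintype.card G : F) - 1 ≠ 0) (s : Fin 3 ⊕ Fin 3) :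
    stdProj F G * stdMatrix F x s = stdMatrix F x s := by
  rw [stdMatrix, ← Matrix.mul_assoc, stdProj_mul_self h1]

theorem stdMatrix_mulVec_classVec (hG : IsElementaryAbelianTwoGroup G)
    (h1 : (Fintype.card G : F) - 1 ≠ 0) (s : Fin 3 ⊕ Fin 3) (c : Fin (4 + 1)) :
    stdMatrix F x s *ᵥ classVec F x c = 0 := by
  obtain ⟨r, hr⟩ := exists_incMatrix_mulVec (F := F) (x := x) hG s c
  rw [stdMatrix, ← Matrix.mulVec_mulVec, hr, Matrix.mulVec_smul, stdProj_mulVec_nonOneVec h1,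
    smul_zero]

/-- The projection is symmetric and idempotent, so it appears once in the middle; its rank-one part
contributes a multiple of an all-one block. -/
theorem transpose_stdMatrix_mul (hG : IsElementaryAbelianTwoGroup G)
    (h1 : (Fintype.card G : F) - 1 ≠ 0) (s t : Fin 3 ⊕ Fin 3) : ∃ r : F, ∃ a c,
    (stdMatrix F x s)ᵀ * stdMatrix F x t = (incMatrix F x s)ᵀ * incMatrix F x t -
      r • vecMulVec (classVec F x a) (classVec F x c) := by
  obtain ⟨a, ha⟩ := exists_nonOneVec_vecMul_incMatrix (F := F) (x := x) hG s
  obtain ⟨c, hc⟩ := exists_nonOneVec_vecMul_incMatrix (F := F) (x := x) hG t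
  refine ⟨((Fintype.card G : F) - 1)⁻¹, a, c, ?_⟩
  rw [stdMatrix, stdMatrix, Matrix.transpose_mul, stdProj_transpose, Matrix.mul_assoc,
    ← Matrix.mul_assoc (stdProj F G), stdProj_mul_self h1, stdProj, Matrix.sub_mul,
    diagonal_mul_incMatrix hG, Matrix.mul_sub, Matrix.smul_mul, Matrix.mul_smul,
    Matrix.vecMulVec_mul, Matrix.mul_vecMulVec, hc, Matrix.mulVec_transpose, ha]

theorem stdMatrix_mul_transpose (s t : Fin 3 ⊕ Fin 3) :
    stdMatrix F x s * (stdMatrix F x t)ᵀ =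
      stdProj F G * (incMatrix F x s * (incMatrix F x t)ᵀ) * stdProj F G := by
  simp only [stdMatrix, Matrix.transpose_mul, stdProj_transpose, Matrix.mul_assoc]

theorem stdProj_mul_diagonal_mul (h1 : (Fintype.card G : F) - 1 ≠ 0) :
    stdProj F G * diagonal (nonOneVec F G) * stdProj F G = stdProj F G := by
  rw [stdProj_mul_diagonal, stdProj_mul_self h1]

theorem stdMatrix_inl_mul_inl (hG : IsElementaryAbelianTwoGroup G)
    (h1 : (Fintype.card G : F) - 1 ≠ 0) (i j : Fin 3) :
    stdMatrix F x (Sum.inl i) * (stdMatrix F x (Sum.inl j))ᵀ =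
      if i = j then stdProj F G else 0 := by
  rw [stdMatrix_mul_transpose, incMatrix, Sum.elim_inl, Sum.elim_inl, lineMatrix_mul_transpose hG]
  split_ifs
  · rw [stdProj_mul_diagonal_mul h1]
  · simp

theorem stdMatrix_inl_mul_inr (hG : IsElementaryAbelianTwoGroup G) (i j : Fin 3) :
    stdMatrix F x (Sum.inl i) * (stdMatrix F x (Sum.inr j))ᵀ = 0 := by
  rw [stdMatrix_mul_transpose, incMatrix, Sum.elim_inl, Sum.elim_inr, lineMatrix_mul_genMatrix hG]
  simp

theorem stdMatrix_inr_mul_inl (hG : IsElementaryAbelianTwoGroup G) (i j : Fin 3) :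
    stdMatrix F x (Sum.inr i) * (stdMatrix F x (Sum.inl j))ᵀ = 0 := by
  rw [stdMatrix_mul_transpose, incMatrix, Sum.elim_inl, Sum.elim_inr, genMatrix_mul_lineMatrix hG]
  simp

theorem stdMatrix_inr_mul_inr (hG : IsElementaryAbelianTwoGroup G)
    (h1 : (Fintype.card G : F) - 1 ≠ 0) (i j : Fin 3) :
    stdMatrix F x (Sum.inr i) * (stdMatrix F x (Sum.inr j))ᵀ =
      (if i = j then (Fintype.card G : F) - 2 else -1) • stdProj F G := by
  rw [stdMatrix_mul_transpose, incMatrix, Sum.elim_inr, Sum.elim_inr]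
  split_ifs with h
  · rw [h, genMatrix_mul_transpose_self hG, Matrix.mul_smul, Matrix.smul_mul,
      stdProj_mul_diagonal_mul h1]
  · rw [genMatrix_mul_transpose_of_ne hG h, Matrix.mul_sub, stdProj_mul_vecMulVec h1, zero_sub,
      Matrix.neg_mul, stdProj_mul_diagonal_mul h1, neg_one_smul]

variable (F) (x) in
/-- Pairwise orthogonal combinations of the matrices `stdMatrix`. -/
noncomputable def orthoMatrix : Fin 3 ⊕ Fin 3 → Matrix G (CayleyTriple G) F :=
  Sum.elim (fun i => stdMatrix F x (Sum.inl i))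
    ![stdMatrix F x (Sum.inr 0) - stdMatrix F x (Sum.inr 1),
      stdMatrix F x (Sum.inr 0) + stdMatrix F x (Sum.inr 1) - (2 : F) • stdMatrix F x (Sum.inr 2),
      stdMatrix F x (Sum.inr 0) + stdMatrix F x (Sum.inr 1) + stdMatrix F x (Sum.inr 2)]

variable (F) (G) in
/-- The squared norms of the matrices `orthoMatrix`. -/
def orthoNorm : Fin 3 ⊕ Fin 3 → F :=
  Sum.elim (fun _ => 1) ![2 * ((Fintype.card G : F) - 1), 6 * ((Fintype.card G : F) - 1),
    3 * ((Fintype.card G : F) - 4)]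

/-- The combinations use the eigenvectors (1, -1, 0), (1, 1, -2), (1, 1, 1) of (n - 1)I - J, with
squared lengths 2, 6, 3. -/
theorem orthoMatrix_mul_transpose (hG : IsElementaryAbelianTwoGroup G)
    (h1 : (Fintype.card G : F) - 1 ≠ 0) (s t : Fin 3 ⊕ Fin 3) :
    orthoMatrix F x s * (orthoMatrix F x t)ᵀ =
      if s = t then orthoNorm F G s • stdProj F G else 0 := by
  rcases s with i | i <;> rcases t with j | j
  · simp [orthoMatrix, orthoNorm, stdMatrix_inl_mul_inl hG h1]
  · fin_cases j <;>
      simp [orthoMatrix, stdMatrix_inl_mul_inr hG, Matrix.mul_add, Matrix.mul_sub]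
  · fin_cases i <;>
      simp [orthoMatrix, stdMatrix_inr_mul_inl hG, Matrix.add_mul, Matrix.sub_mul]
  · fin_cases i <;> fin_cases j <;>
      simp [orthoMatrix, orthoNorm, stdMatrix_inr_mul_inr hG h1, Matrix.add_mul, Matrix.sub_mul,
        Matrix.mul_add, Matrix.mul_sub] <;> module

theorem stdProj_mul_orthoMatrix (h1 : (Fintype.card G : F) - 1 ≠ 0) (s : Fin 3 ⊕ Fin 3) :
    stdProj F G * orthoMatrix F x s = orthoMatrix F x s := by
  rcases s with i | i
  · exact stdProj_mul_stdMatrix h1 _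
  · fin_cases i <;>
      simp [orthoMatrix, stdProj_mul_stdMatrix h1, Matrix.mul_add, Matrix.mul_sub]

theorem orthoMatrix_mem_span (s : Fin 3 ⊕ Fin 3) :
    orthoMatrix F x s ∈ Submodule.span F (Set.range (stdMatrix F x)) := by
  have h := fun s => Submodule.subset_span (R := F) (Set.mem_range_self (f := stdMatrix F x) s)
  rcases s with i | i
  · exact h _
  · fin_cases i
    · exact Submodule.sub_mem _ (h _) (h _)
    · exact Submodule.sub_mem _ (Submodule.add_mem _ (h _) (h _)) (Submodule.smul_mem _ _ (h _))
    · exact Submodule.add_mem _ (Submodule.add_mem _ (h _) (h _)) (h _)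

theorem stdMatrix_mem_span (hF2 : (2 : F) ≠ 0) (hF3 : (3 : F) ≠ 0) (s : Fin 3 ⊕ Fin 3) :
    stdMatrix F x s ∈ Submodule.span F (Set.range (orthoMatrix F x)) := by
  have h := fun s => Submodule.subset_span (R := F) (Set.mem_range_self (f := orthoMatrix F x) s)
  have hF6 : (6 : F) ≠ 0 := by
    have : (6 : F) = 2 * 3 := by norm_num
    rw [this]
    exact mul_ne_zero hF2 hF3
  have key : ∀ v : Matrix G (CayleyTriple G) F,
      (6 : F) • v ∈ Submodule.span F (Set.range (orthoMatrix F x)) →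
        v ∈ Submodule.span F (Set.range (orthoMatrix F x)) := by
    intro v hv
    have := Submodule.smul_mem _ (6 : F)⁻¹ hv
    rwa [smul_smul, inv_mul_cancel₀ hF6, one_smul] at this
  rcases s with i | i
  · exact h (Sum.inl i)
  · have hmem : ∀ r₀ r₁ r₂ : F,
        r₀ • orthoMatrix F x (Sum.inr 0) + r₁ • orthoMatrix F x (Sum.inr 1) +
        r₂ • orthoMatrix F x (Sum.inr 2) ∈ Submodule.span F (Set.range (orthoMatrix F x)) :=
      fun r₀ r₁ r₂ => Submodule.add_mem _ (Submodule.add_mem _ (Submodule.smul_mem _ _ (h _))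
        (Submodule.smul_mem _ _ (h _))) (Submodule.smul_mem _ _ (h _))
    apply key
    fin_cases i
    -- The coefficients are 6 times the inverse of the change of basis to these eigenvectors.
    · convert hmem 3 1 2 using 1
      simp [orthoMatrix]
      module
    · convert hmem (-3) 1 2 using 1
      simp [orthoMatrix]
      module
    · convert hmem 0 (-2) 2 using 1
      simp [orthoMatrix]
      module

/-- In a group of order 4 the three coordinates of a generic point exhaust the nontrivial elements.
-/
theorem genSum_eq_vecMulVec (hG : IsElementaryAbelianTwoGroup G) (hn : Fintype.card G = 4) :
    genSum F x = vecMulVec (nonOneVec F G) (classVec F x 4) := by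
  ext g z
  simp only [genSum, genMatrix, coordMatrix, Matrix.add_apply, Matrix.of_apply, vecMulVec_apply]
  rw [← mul_add, ← mul_add, mul_comm]
  by_cases hz : cayleyScheme G 4 x z
  · congr 1
    have h := fun {i j} h => (cayleyScheme_four_iff hG (i := i) (j := j) h x z).1 hz
    obtain ⟨h0, h1, h01⟩ := h (i := 0) (j := 1) (by decide)
    obtain ⟨-, h2, h02⟩ := h (i := 0) (j := 2) (by decide)
    obtain ⟨-, -, h12⟩ := h (i := 1) (j := 2) (by decide)
    have hcard : ({1, relCoord x z 0, relCoord x z 1, relCoord x z 2} : Finset G).card = 4 := by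
      rw [Finset.card_insert_of_notMem, Finset.card_insert_of_notMem,
        Finset.card_insert_of_notMem, Finset.card_singleton]
      · simpa using h12
      · simp [h01, h02]
      · simp [Ne.symm h0, Ne.symm h1, Ne.symm h2]
    have huniv := Finset.eq_univ_of_card _ (hcard.trans hn.symm)
    have hg : g ∈ ({1, relCoord x z 0, relCoord x z 1, relCoord x z 2} : Finset G) :=
      huniv ▸ Finset.mem_univ g
    simp only [Finset.mem_insert, Finset.mem_singleton] at hg
    rcases hg with rfl | rfl | rfl | rfl
    · simp [nonOneVec, h0, h1, h2]
    · simp [nonOneVec, h0, Ne.symm h01, Ne.symm h02]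
    · simp [nonOneVec, h1, h01, Ne.symm h12]
    · simp [nonOneVec, h2, h02, h12]
  · simp [classVec, hz]

/-- Only the norm 3(n - 4) can vanish, and then |G| = 4; the sum of the N_i has every column a
multiple of u, so the projection kills it. -/
theorem orthoMatrix_eq_zero (hG : IsElementaryAbelianTwoGroup G)
    (h1 : (Fintype.card G : F) - 1 ≠ 0) (hF2 : (2 : F) ≠ 0) (hF3 : (3 : F) ≠ 0)
    (h4 : (Fintype.card G : F) - 4 ≠ 0 ∨ Fintype.card G = 4) {s : Fin 3 ⊕ Fin 3}
    (hs : orthoNorm F G s = 0) : orthoMatrix F x s = 0 := by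
  have hF6 : (6 : F) ≠ 0 := by
    have : (6 : F) = 2 * 3 := by norm_num
    rw [this]
    exact mul_ne_zero hF2 hF3
  rcases s with i | i
  · exact absurd hs one_ne_zero
  · fin_cases i
    · exact absurd hs (mul_ne_zero hF2 h1)
    · exact absurd hs (mul_ne_zero hF6 h1)
    · rcases h4 with h4 | h4
      · exact absurd hs (mul_ne_zero hF3 h4)
      · change stdMatrix F x (Sum.inr 0) + stdMatrix F x (Sum.inr 1) +
          stdMatrix F x (Sum.inr 2) = 0
        simp only [stdMatrix, ← Matrix.mul_add]
        change stdProj F G * genSum F x = 0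
        rw [genSum_eq_vecMulVec hG h4, stdProj_mul_vecMulVec h1]

theorem sum_classVec_ne_zero (hG : IsElementaryAbelianTwoGroup G)
    (h1 : (Fintype.card G : F) - 1 ≠ 0) (h2 : (Fintype.card G : F) - 2 ≠ 0) (c : Fin (4 + 1)) :
    ∑ z, classVec F x c z ≠ 0 := by
  rcases fin_five_cases c with rfl | ⟨i, rfl⟩ | rfl
  · rw [sum_classVec_zero]
    exact one_ne_zero
  · rwa [sum_classVec_line hG]
  · rw [sum_classVec_four hG]
    exact mul_ne_zero h1 h2

/-- T coincides with the semisimple algebra generated by two mutually annihilating matrix algebras: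
φ comes from the class vectors, ψ from the orthogonal matrices on the sum-zero part. -/
theorem isSemisimpleRing_terwilligerAlgebra (hG : IsElementaryAbelianTwoGroup G)
    (h1 : (Fintype.card G : F) - 1 ≠ 0) (h2 : (Fintype.card G : F) - 2 ≠ 0) (hF2 : (2 : F) ≠ 0)
    (hF3 : (3 : F) ≠ 0) (h4 : (Fintype.card G : F) - 4 ≠ 0 ∨ Fintype.card G = 4) :
    IsSemisimpleRing (terwilligerAlgebra F (cayleyScheme G) x) := by
  classical
  let φ := gramHom (fun c => Matrix.replicateRow Unit (classVec F x c)) 1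
    (fun c => ∑ z, classVec F x c z) (sum_classVec_ne_zero hG h1 h2)
    (fun a c => by
      have := classVec_dotProduct (F := F) (x := x) hG a c
      ext i j
      simp only [Matrix.mul_apply, Matrix.transpose_apply, Matrix.replicateRow_apply]
      rw [← dotProduct, this]
      split_ifs <;> simp)
    (fun c => Matrix.one_mul _)
  -- Indices of zero norm are left out; by `orthoMatrix_eq_zero` their matrices vanish, so nothing
  -- is lost.
  let ψ := gramHom (fun s : {s // orthoNorm F G s ≠ 0} => orthoMatrix F x s) (stdProj F G)
    (fun s => orthoNorm F G s) (fun s => s.2)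
    (fun s t => by
      rw [orthoMatrix_mul_transpose hG h1]
      simp only [Subtype.ext_iff])
    (fun s => stdProj_mul_orthoMatrix h1 s)
  have hort : ∀ s c, orthoMatrix F x s *ᵥ classVec F x c = 0 := by
    intro s c
    rcases s with i | i
    · exact stdMatrix_mulVec_classVec hG h1 _ _
    · fin_cases i <;> simp [orthoMatrix, Matrix.add_mulVec, Matrix.sub_mulVec, Matrix.smul_mulVec,
        stdMatrix_mulVec_classVec hG h1]
  have hrow : ∀ a c, (Matrix.replicateRow Unit (classVec F x a))ᵀ *
      Matrix.replicateRow Unit (classVec F x c) =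
      vecMulVec (classVec F x a) (classVec F x c) := by
    intro a c
    ext y z
    simp [Matrix.mul_apply, vecMulVec_apply]
  obtain ⟨S, hS, hφ, hψ, hST⟩ := exists_isSemisimpleRing_subalgebra φ ψ
    (gramHom_mul_gramHom_eq_zero fun c s => by
      ext i g
      exact (dotProduct_comm _ _).trans (congrFun (hort s c) g))
    (fun a b => gramHom_mul_gramHom_eq_zero (fun s c => by
      ext g i
      exact congrFun (hort s c) g) b a)
  have hJ : ∀ a c, vecMulVec (classVec F x a) (classVec F x c) ∈ S := by
    intro a c
    rw [← hrow]
    exact transpose_mul_mem_of_gramHom_mem hφ a c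
  have hO : ∀ s t, (orthoMatrix F x s)ᵀ * orthoMatrix F x t ∈ S := by
    intro s t
    by_cases hs : orthoNorm F G s = 0
    · rw [orthoMatrix_eq_zero hG h1 hF2 hF3 h4 hs, Matrix.transpose_zero, Matrix.zero_mul]
      exact zero_mem _
    · by_cases ht : orthoNorm F G t = 0
      · rw [orthoMatrix_eq_zero hG h1 hF2 hF3 h4 ht, Matrix.mul_zero]
        exact zero_mem _
      · exact transpose_mul_mem_of_gramHom_mem hψ ⟨s, hs⟩ ⟨t, ht⟩
  have hQ : ∀ s t, (incMatrix F x s)ᵀ * incMatrix F x t ∈ S := by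
    intro s t
    obtain ⟨r, a, c, h⟩ := transpose_stdMatrix_mul (F := F) (x := x) hG h1 s t
    rw [eq_sub_iff_add_eq] at h
    rw [← h]
    refine add_mem ?_ (S.smul_mem (hJ a c) r)
    refine transpose_mul_mem_of_mem_span (S := Subalgebra.toSubmodule S) ?_
      (stdMatrix_mem_span hF2 hF3 s) (stdMatrix_mem_span hF2 hF3 t)
    rintro _ ⟨s, rfl⟩ _ ⟨t, rfl⟩
    exact hO s t
  have hD : diagonal (classVec F x 4) ∈ S := by
    -- The generic idempotent is the complement of the other four, so the unit of S supplies it.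
    have e : diagonal (classVec F x 4) = 1 - (vecMulVec (classVec F x 0) (classVec F x 0) +
        (lineMatrix F x 0)ᵀ * lineMatrix F x 0 + (lineMatrix F x 1)ᵀ * lineMatrix F x 1 +
        (lineMatrix F x 2)ᵀ * lineMatrix F x 2) := by
      have h0 : vecMulVec (classVec F x 0) (classVec F x 0) = diagonal (classVec F x 0) := by
        ext y z
        simp only [diagonal_apply, vecMulVec_apply, classVec_zero]
        split_ifs <;> simp_all
      have hsum : (1 : Matrix (CayleyTriple G) (CayleyTriple G) F) =
          ∑ c, diagonal (classVec F x c) := by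
        ext y z
        simp only [Matrix.sum_apply, diagonal_apply, Matrix.one_apply]
        split_ifs
        · rw [sum_classVec hG]
        · simp
      simp only [transpose_lineMatrix_mul_self hG]
      rw [h0, hsum, Fin.sum_univ_five, eq_sub_iff_add_eq, add_comm]
      rfl
    rw [e]
    exact sub_mem (one_mem _) (add_mem (add_mem (add_mem (hJ 0 0) (hQ (Sum.inl 0) (Sum.inl 0)))
      (hQ (Sum.inl 1) (Sum.inl 1))) (hQ (Sum.inl 2) (Sum.inl 2)))
  have hTS : terwilligerAlgebra F (cayleyScheme G) x ≤ S :=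
    terwilligerAlgebra_le (terwilligerGen_mem hG (Subalgebra.toSubmodule S) hJ hQ hD)
  have hSub : S ≤ terwilligerAlgebra F (cayleyScheme G) x := by
    refine hST _ (gramHom_mem fun a c => ?_) (gramHom_mem fun s t => ?_)
    · rw [hrow]
      exact vecMulVec_mem_terwilligerAlgebra hG a c
    · refine transpose_mul_mem_of_mem_span
        (S := Subalgebra.toSubmodule (terwilligerAlgebra F (cayleyScheme G) x)) ?_
        (orthoMatrix_mem_span s.1) (orthoMatrix_mem_span t.1)
      rintro _ ⟨s, rfl⟩ _ ⟨t, rfl⟩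
      obtain ⟨r, a, c, h⟩ := transpose_stdMatrix_mul (F := F) (x := x) hG h1 s t
      rw [h]
      exact sub_mem (incMatrix_mem_terwilligerAlgebra hG s t)
        (Subalgebra.smul_mem _ (vecMulVec_mem_terwilligerAlgebra hG a c) r)
  rw [le_antisymm hTS hSub]
  exact hS

end Semisimple

/-! ### The Cayley relations form a symmetric association scheme. -/

section Scheme

variable {G : Type*} [Group G]

theorem cayleyScheme_symm (c : Fin (4 + 1)) (x y : CayleyTriple G) (h : cayleyScheme G c x y) :
    cayleyScheme G c y x := by
  rcases fin_five_cases c with rfl | ⟨i, rfl⟩ | rfl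
  · exact Eq.symm h
  · rw [cayleyScheme_succ] at h ⊢
    exact ⟨h.1.symm, h.2.symm⟩
  · rw [cayleyScheme_four] at h ⊢
    exact ⟨h.1.symm, fun j => (h.2 j).symm⟩

variable [DecidableEq G]

variable (G) in
/-- The matrix of the relation of agreeing in the `i`-th coordinate. -/
def agreeMatrix (i : Fin 3) : Matrix (CayleyTriple G) (CayleyTriple G) ℚ :=
  Matrix.of fun x y => if x.1 i = y.1 i then 1 else 0

variable (G) in
/-- A spanning set of the adjacency algebra. -/
def adjacencySpan : Set (Matrix (CayleyTriple G) (CayleyTriple G) ℚ) :=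
  {1, Matrix.of fun _ _ => 1} ∪ Set.range (agreeMatrix G)

theorem apply_eq_of_mem_span (hG : IsElementaryAbelianTwoGroup G)
    {M : Matrix (CayleyTriple G) (CayleyTriple G) ℚ}
    (hM : M ∈ Submodule.span ℚ (adjacencySpan G)) {c : Fin (4 + 1)} {x y x' y' : CayleyTriple G}
    (h : cayleyScheme G c x y) (h' : cayleyScheme G c x' y') : M x y = M x' y' := by
  have key : ∀ d, cayleyScheme G d x y ↔ cayleyScheme G d x' y' := fun d =>
    ⟨fun hd => (cayleyScheme_existsUnique hG x y).unique h hd ▸ h',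
      fun hd => (cayleyScheme_existsUnique hG x' y').unique h' hd ▸ h⟩
  have h0 : x = y ↔ x' = y' := key 0
  induction hM using Submodule.span_induction with
  | mem M hM =>
    rcases hM with (rfl | rfl) | ⟨i, rfl⟩
    · simp only [Matrix.one_apply, h0]
    · rfl
    · have hi := key (lineIdx i)
      rw [cayleyScheme_succ, cayleyScheme_succ] at hi
      have : x.1 i = y.1 i ↔ x'.1 i = y'.1 i := by
        by_cases e : x = y
        · rw [e, h0.1 e]
          simp
        · simpa [e, mt h0.2 e] using hi
      simp only [agreeMatrix, Matrix.of_apply, this]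
  | zero => rfl
  | add M N _ _ hM hN => rw [Matrix.add_apply, Matrix.add_apply, hM, hN]
  | smul r M _ hM => rw [Matrix.smul_apply, Matrix.smul_apply, hM]

theorem agreeMatrix_comm (i : Fin 3) (x y : CayleyTriple G) :
    agreeMatrix G i x y = agreeMatrix G i y x := by
  simp only [agreeMatrix, Matrix.of_apply, eq_comm]

theorem of_classVec_mem_span (hG : IsElementaryAbelianTwoGroup G) (c : Fin (4 + 1)) :
    (Matrix.of fun x y => classVec ℚ x c y : Matrix (CayleyTriple G) (CayleyTriple G) ℚ) ∈
      Submodule.span ℚ (adjacencySpan G) := by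
  have h0 : (Matrix.of fun x y => classVec ℚ x 0 y : Matrix (CayleyTriple G) (CayleyTriple G) ℚ) ∈
      Submodule.span ℚ (adjacencySpan G) := by
    refine Submodule.subset_span (Or.inl (Or.inl ?_))
    ext x y
    simp [classVec_zero, Matrix.one_apply]
  have hl : ∀ i, (Matrix.of fun x y => classVec ℚ x (lineIdx i) y :
      Matrix (CayleyTriple G) (CayleyTriple G) ℚ) ∈ Submodule.span ℚ (adjacencySpan G) := by
    intro i
    have hD : agreeMatrix G i ∈ adjacencySpan G := Or.inr ⟨i, rfl⟩
    convert Submodule.sub_mem _ (Submodule.subset_span (R := ℚ) hD) h0 using 1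
    ext x y
    simp only [Matrix.of_apply, Matrix.sub_apply, agreeMatrix, classVec, cayleyScheme_succ,
      cayleyScheme_zero]
    by_cases h : x = y
    · simp [h]
    · simp [h]
  rcases fin_five_cases c with rfl | ⟨i, rfl⟩ | rfl
  · exact h0
  · exact hl i
  · have hall : (Matrix.of fun _ _ => 1) ∈ adjacencySpan G := Or.inl (Or.inr rfl)
    convert Submodule.sub_mem _ (Submodule.subset_span (R := ℚ) hall)
      (Submodule.add_mem _ (Submodule.add_mem _ (Submodule.add_mem _ h0 (hl 0)) (hl 1)) (hl 2)) using 1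
    ext x y
    have := sum_classVec (F := ℚ) (x := x) hG y
    rw [Fin.sum_univ_five] at this
    simp only [Matrix.of_apply, Matrix.sub_apply, Matrix.add_apply]
    rw [eq_sub_iff_add_eq, ← this, add_comm]
    rfl

variable [Fintype G]

theorem agreeMatrix_mul_of_ne (hG : IsElementaryAbelianTwoGroup G) {i j : Fin 3} (h : i ≠ j) :
    agreeMatrix G i * agreeMatrix G j = Matrix.of fun _ _ => 1 := by
  ext x y
  simp only [Matrix.mul_apply, agreeMatrix, Matrix.of_apply]
  simp only [← relCoord_eq_one, ← relCoord_inj (x := x) (z := y)]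
  rw [sum_relCoord hG h x fun a b => (if a = 1 then (1 : ℚ) else 0) *
    if b = relCoord x y j then 1 else 0]
  simp

theorem sum_agreeMatrix (hG : IsElementaryAbelianTwoGroup G) (i : Fin 3) (x : CayleyTriple G) :
    ∑ z, agreeMatrix G i x z = Fintype.card G := by
  simp only [agreeMatrix, Matrix.of_apply, ← relCoord_eq_one]
  rw [sum_relCoord hG (ne_add_one i) x fun a _ => if a = 1 then (1 : ℚ) else 0]
  simp

theorem agreeMatrix_mul_self (hG : IsElementaryAbelianTwoGroup G) (i : Fin 3) :
    agreeMatrix G i * agreeMatrix G i = (Fintype.card G : ℚ) • agreeMatrix G i := by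
  ext x y
  have : ∀ z, agreeMatrix G i x z * agreeMatrix G i z y =
      agreeMatrix G i x z * agreeMatrix G i x y := by
    intro z
    simp only [agreeMatrix, Matrix.of_apply]
    by_cases h : x.1 i = z.1 i
    · rw [h]
    · simp [h]
  rw [Matrix.mul_apply, Finset.sum_congr rfl fun z _ => this z, ← Finset.sum_mul,
    sum_agreeMatrix hG, Matrix.smul_apply, smul_eq_mul]

/-- The span of I, J and the three agreement matrices is closed under products. As its members are
constant on each relation, the intersection numbers, which are entries of products of adjacency
matrices, are well defined. -/
theorem mul_mem_span_adjacencySpan (hG : IsElementaryAbelianTwoGroup G)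
    {M N : Matrix (CayleyTriple G) (CayleyTriple G) ℚ}
    (hM : M ∈ Submodule.span ℚ (adjacencySpan G)) (hN : N ∈ Submodule.span ℚ (adjacencySpan G)) :
    M * N ∈ Submodule.span ℚ (adjacencySpan G) := by
  have hall : (Matrix.of fun _ _ => 1 : Matrix (CayleyTriple G) (CayleyTriple G) ℚ) ∈
      Submodule.span ℚ (adjacencySpan G) := Submodule.subset_span (Or.inl (Or.inr rfl))
  have hD : ∀ i, agreeMatrix G i ∈ Submodule.span ℚ (adjacencySpan G) := fun i =>
    Submodule.subset_span (Or.inr ⟨i, rfl⟩)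
  induction hM, hN using Submodule.span_induction₂ with
  | mem_mem M N hM hN =>
    have hN' := Submodule.subset_span (R := ℚ) hN
    have hM' := Submodule.subset_span (R := ℚ) hM
    rcases hM with (rfl | rfl) | ⟨i, rfl⟩
    · rwa [Matrix.one_mul]
    · rcases hN with (rfl | rfl) | ⟨j, rfl⟩
      · rwa [Matrix.mul_one]
      · convert Submodule.smul_mem _ (Fintype.card (CayleyTriple G) : ℚ) hall using 1
        ext x y
        simp [Matrix.mul_apply]
      · convert Submodule.smul_mem _ (Fintype.card G : ℚ) hall using 1
        ext x y
        simp only [Matrix.mul_apply, Matrix.of_apply, one_mul, agreeMatrix_comm j _ y,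
          sum_agreeMatrix hG, Matrix.smul_apply, smul_eq_mul, mul_one]
    · rcases hN with (rfl | rfl) | ⟨j, rfl⟩
      · rwa [Matrix.mul_one]
      · convert Submodule.smul_mem _ (Fintype.card G : ℚ) hall using 1
        ext x y
        simp only [Matrix.mul_apply, Matrix.of_apply, mul_one,
          sum_agreeMatrix hG, Matrix.smul_apply, smul_eq_mul]
      · by_cases h : i = j
        · rw [h, agreeMatrix_mul_self hG]
          exact Submodule.smul_mem _ _ (hD j)
        · rwa [agreeMatrix_mul_of_ne hG h]
  | zero_left w _ => simp
  | zero_right v _ => simp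
  | add_left u v w _ _ _ hu hv =>
    rw [Matrix.add_mul]
    exact Submodule.add_mem _ hu hv
  | add_right u v w _ _ _ hu hv =>
    rw [Matrix.mul_add]
    exact Submodule.add_mem _ hu hv
  | smul_left r u v _ _ hu =>
    rw [Matrix.smul_mul]
    exact Submodule.smul_mem _ _ hu
  | smul_right r u v _ _ hu =>
    rw [Matrix.mul_smul]
    exact Submodule.smul_mem _ _ hu

theorem exists_cayleyScheme (hG : IsElementaryAbelianTwoGroup G) (hn : 3 ≤ Fintype.card G)
    (x : CayleyTriple G) (c : Fin (4 + 1)) : ∃ y, cayleyScheme G c x y := by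
  have hF : ((Fintype.card G : ℚ) - 1) ≠ 0 ∧ ((Fintype.card G : ℚ) - 2) ≠ 0 := by
    have : (3 : ℚ) ≤ Fintype.card G := by exact_mod_cast hn
    constructor <;> linarith
  obtain ⟨z, -, hz⟩ := Finset.exists_ne_zero_of_sum_ne_zero
    (sum_classVec_ne_zero (F := ℚ) (x := x) hG hF.1 hF.2 c)
  refine ⟨z, by_contra fun h => hz ?_⟩
  simp [classVec, h]

theorem isSymmetricScheme_cayleyScheme (hG : IsElementaryAbelianTwoGroup G)
    (hn : 3 ≤ Fintype.card G) : IsSymmetricScheme (cayleyScheme G) := by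
  refine ⟨⟨fun i => ?_, cayleyScheme_existsUnique hG, cayleyScheme_zero, fun i => ⟨i, fun x y =>
    ⟨cayleyScheme_symm i x y, cayleyScheme_symm i y x⟩⟩, ?_⟩, cayleyScheme_symm⟩
  · exact ⟨⟨fun _ => 1, one_mul 1⟩, exists_cayleyScheme hG hn _ i⟩
  · classical
    intro g h i x y x' y' hxy hxy'
    have key : ∀ x y, (Nat.card {z // cayleyScheme G g x z ∧ cayleyScheme G h z y} : ℚ) =
        ((Matrix.of fun x y => classVec ℚ x g y) * (Matrix.of fun x y => classVec ℚ x h y) :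
          Matrix (CayleyTriple G) (CayleyTriple G) ℚ) x y := by
      intro x y
      rw [Nat.card_eq_fintype_card, Fintype.card_subtype, Finset.card_filter, Nat.cast_sum,
        Matrix.mul_apply]
      refine Finset.sum_congr rfl fun z _ => ?_
      simp only [Matrix.of_apply, classVec]
      split_ifs <;> simp_all
    have := apply_eq_of_mem_span hG (mul_mem_span_adjacencySpan hG (of_classVec_mem_span hG g)
      (of_classVec_mem_span hG h)) hxy hxy'
    rw [← key, ← key] at this
    exact_mod_cast this

theorem natCast_valency {F : Type*} [Field F] (c : Fin (4 + 1)) (x : CayleyTriple G) :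
    (valency (cayleyScheme G) c x : F) = ∑ z, classVec F x c z := by
  classical
  rw [valency, Nat.card_eq_fintype_card, Fintype.card_subtype, Finset.card_filter, Nat.cast_sum]
  refine Finset.sum_congr rfl fun z _ => ?_
  simp [classVec]

end Scheme

/-! ### Arithmetic of |G| in F and the final theorem. -/

section Main

theorem IsElementaryAbelianTwoGroup.exists_card_eq {G : Type*} [Group G] [Fintype G]
    (hG : IsElementaryAbelianTwoGroup G) : ∃ m, Fintype.card G = 2 ^ m := by
  have : Fact (Nat.Prime 2) := ⟨Nat.prime_two⟩
  have h : IsPGroup 2 G := fun g => ⟨1, by rw [pow_one, hG.2]⟩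
  obtain ⟨m, hm⟩ := IsPGroup.iff_card.1 h
  exact ⟨m, by rw [← hm, Nat.card_eq_fintype_card]⟩

theorem isSemisimpleRing_terwilligerAlgebra_iff {F : Type*} [Field F] {G : Type*} [Group G]
    [Fintype G] [DecidableEq G] (hG : IsElementaryAbelianTwoGroup G) (hn : 3 ≤ Fintype.card G)
    (x : CayleyTriple G) : IsSemisimpleRing (terwilligerAlgebra F (cayleyScheme G) x) ↔
      (Fintype.card G : F) ≠ 1 ∧ (Fintype.card G : F) ≠ 2 ∧
        ((Fintype.card G : F) ≠ 4 ∨ Fintype.card G = 4) := by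
  obtain ⟨m, hm⟩ := hG.exists_card_eq
  have hm0 : m ≠ 0 := by
    rintro rfl
    omega
  have hmF : (Fintype.card G : F) = 2 ^ m := by
    rw [hm]
    push_cast
    rfl
  have h2 : (Fintype.card G : F) ≠ 2 → (2 : F) ≠ 0 := by
    intro h e
    rw [hmF, e, zero_pow hm0] at h
    exact h rfl
  -- In characteristic 3 one has 2 = -1, so 2^m is 1 or 2 in F.
  have h3 : (Fintype.card G : F) ≠ 1 → (Fintype.card G : F) ≠ 2 → (3 : F) ≠ 0 := by
    intro h h' e
    have e' : (2 : F) = -1 := by linear_combination e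
    rw [hmF, e'] at h h'
    rcases neg_one_pow_eq_or F m with e | e
    · exact h e
    · exact h' e
  constructor
  · intro hT
    have h12 : ((Fintype.card G : F) - 1) * ((Fintype.card G : F) - 2) ≠ 0 := fun h =>
      not_isSemisimpleRing_of_card_sub_mul_eq_zero hG hn h hT
    rw [mul_ne_zero_iff, sub_ne_zero, sub_ne_zero] at h12
    refine ⟨h12.1, h12.2, ?_⟩
    by_contra! h
    refine not_isSemisimpleRing_of_card_eq_four hG ?_ h.1 (h2 h12.2) (h3 h12.1 h12.2) hT
    have : Fintype.card G ≠ 3 := by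
      intro e
      have := h.1
      rw [e] at this
      push_cast at this
      exact one_ne_zero (α := F) (by linear_combination -this)
    omega
  · rintro ⟨h1', h2', h4'⟩
    exact isSemisimpleRing_terwilligerAlgebra hG (sub_ne_zero.2 h1') (sub_ne_zero.2 h2') (h2 h2')
      (h3 h1' h2') (h4'.imp_left sub_ne_zero.2)

theorem isElementaryAbelianTwoGroup_elemAbTwo (m : ℕ) :
    IsElementaryAbelianTwoGroup (ElemAbTwo m) := by
  refine ⟨mul_comm, fun a => ?_⟩
  rw [sq]
  apply Multiplicative.toAdd.injective
  funext i
  exact CharTwo.add_self_eq_zero _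

theorem card_elemAbTwo (m : ℕ) : Fintype.card (ElemAbTwo m) = 2 ^ m := by
  rw [Fintype.card_multiplicative]
  simp

/-- The differences 4 - 1 and 4 - 2 are prime, so a modulus other than 1 divides one of them only by
equalling it. -/
theorem four_modEq_iff {p : ℕ} (hp : p ≠ 1) :
    (¬ 4 ≡ 1 [MOD p] ∧ ¬ 4 ≡ 2 [MOD p]) ↔ p ≠ 2 ∧ p ≠ 3 := by
  have h1 : 4 ≡ 1 [MOD p] ↔ p = 3 := by
    rw [Nat.ModEq.comm, Nat.modEq_iff_dvd' (by norm_num), Nat.dvd_prime Nat.prime_three]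
    simp [hp]
  have h2 : 4 ≡ 2 [MOD p] ↔ p = 2 := by
    rw [Nat.ModEq.comm, Nat.modEq_iff_dvd' (by norm_num), Nat.dvd_prime Nat.prime_two]
    simp [hp]
  rw [h1, h2, and_comm]

theorem mainTheorem2 {F : Type*} [Field F] (p : ℕ) [CharP F p] :
    (∀ (G : Type*) [Group G] [Fintype G] [DecidableEq G],
      IsElementaryAbelianTwoGroup G → 3 ≤ Fintype.card G → ∀ x : CayleyTriple G,
        (IsSemisimpleRing (terwilligerAlgebra F (cayleyScheme G) x) ↔
          (p ≠ 2 ∧ p ≠ 3 ∧ Fintype.card G = 4) ∨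
          (¬ Fintype.card G ≡ 1 [MOD p] ∧ ¬ Fintype.card G ≡ 2 [MOD p] ∧
            ¬ Fintype.card G ≡ 4 [MOD p]))) ∧
    (p ≠ 0 → p ≠ 2 → p ≠ 3 →
      {m : ℕ | 3 ≤ Fintype.card (ElemAbTwo m) ∧
        IsSymmetricScheme (cayleyScheme (ElemAbTwo m)) ∧
        (∀ i x, ¬ p ∣ valency (cayleyScheme (ElemAbTwo m)) i x) ∧
        ∀ x : CayleyTriple (ElemAbTwo m),
          ¬ IsSemisimpleRing (terwilligerAlgebra F (cayleyScheme (ElemAbTwo m)) x)}.Infinite) := by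
  have hp1 : p ≠ 1 := CharP.char_ne_one F p
  have hcast : ∀ n k : ℕ, (n : F) = k ↔ n ≡ k [MOD p] := fun n k => CharP.natCast_eq_natCast F p
  constructor
  · intro G _ _ _ hG hn x
    rw [isSemisimpleRing_terwilligerAlgebra_iff hG hn]
    have c1 := hcast (Fintype.card G) 1
    have c2 := hcast (Fintype.card G) 2
    have c4 := hcast (Fintype.card G) 4
    push_cast at c1 c2 c4
    rw [Ne, Ne, Ne, c1, c2, c4]
    have hfour := four_modEq_iff hp1
    -- For |G| = 4 the congruence to 4 always holds, so only the alternative p ≠ 2, 3 remains;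
    -- `hfour` matches it with the other two congruences.
    by_cases h4 : Fintype.card G = 4
    · rw [h4]
      tauto
    · tauto
  · intro hp0 hp2 hp3
    have hp : p.Prime := (CharP.char_is_prime_or_zero F p).resolve_right hp0
    have hp4 : 4 ≤ p := by
      have := hp.two_le
      omega
    -- By Fermat 2^(p-1) ≡ 1 mod p, so these exponents give 2^m ≡ 4; using k + 1 instead of k keeps
    -- m > 2, hence 2^m > 4.
    refine Set.infinite_of_injective_forall_mem (f := fun k : ℕ => 2 + (k + 1) * (p - 1)) ?_ ?_
    · intro k l hkl
      have := Nat.eq_of_mul_eq_mul_right (by omega) (Nat.add_left_cancel hkl)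
      omega
    · intro k
      set m := 2 + (k + 1) * (p - 1) with hmdef
      have hm : 3 ≤ m := by
        have : 1 * (p - 1) ≤ (k + 1) * (p - 1) := Nat.mul_le_mul_right _ (by omega)
        omega
      have hcard : 4 < Fintype.card (ElemAbTwo m) := by
        rw [card_elemAbTwo]
        calc 4 < 2 ^ 3 := by norm_num
          _ ≤ 2 ^ m := Nat.pow_le_pow_right (by norm_num) hm
      have hmod : Fintype.card (ElemAbTwo m) ≡ 4 [MOD p] := by
        have h := Nat.ModEq.pow_totient (x := 2) (n := p)
          ((Nat.coprime_primes Nat.prime_two hp).2 hp2.symm)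
        rw [Nat.totient_prime hp] at h
        rw [card_elemAbTwo, hmdef, pow_add, mul_comm (k + 1), pow_mul]
        simpa using (h.pow (k + 1)).mul_left 4
      have hG := isElementaryAbelianTwoGroup_elemAbTwo m
      have hF : (Fintype.card (ElemAbTwo m) : F) = 4 := by
        exact_mod_cast (hcast _ 4).2 hmod
      have h41 := (four_modEq_iff hp1).2 ⟨hp2, hp3⟩
      rw [← hcast, ← hcast] at h41
      push_cast at h41
      refine ⟨by omega, isSymmetricScheme_cayleyScheme hG (by omega), fun i x hdvd => ?_,
        fun x hT => ?_⟩
      · rw [← CharP.cast_eq_zero_iff F p, natCast_valency] at hdvd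
        exact sum_classVec_ne_zero hG (by rw [hF]; exact sub_ne_zero.2 h41.1)
          (by rw [hF]; exact sub_ne_zero.2 h41.2) i hdvd
      · rcases ((isSemisimpleRing_terwilligerAlgebra_iff hG (by omega) x).1 hT).2.2 with h | h
        · exact h hF
        · omega

end Main
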